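/- Let $1<\alpha<2$, $0\le\beta\le 1$, $\gamma=\alpha+2\beta-\alpha\beta$, $T>0$, $m\in\mathbb N$, and for $i=1,\dots,m$ let $\sigma_i,\mu_i\in\mathbb R$, $\eta_i,\delta_i>0$, $\xi_i\in(0,T)$ with $\mu_i+\frac{\gamma-1}{\eta_i}+1>0$. Write $\mathcal I^{a}y(t)=\frac1{\Gamma(a)}\int_0^t(t-s)^{a-1}y(s)\,ds$ for $a>0$, $\mathcal I^0y=y$, and $$\mathcal I_{\eta}^{\mu,\delta}y(t)=\frac{\eta\,t^{-\eta(\delta+\mu)}}{\Gamma(\delta)}\int_0^t\frac{s^{\eta\mu+\eta-1}y(s)}{(t^\eta-s^\eta)^{1-\delta}}\,ds .$$ Let ${}^H\mathcal D^{\alpha,\beta}y=\mathcal I^{\beta(2-\alpha)}\mathcal D^2\,\mathcal I^{(1-\beta)(2-\alpha)}y$ be the Hilfer derivative, understood in the regularised form ${}^H\mathcal D^{\alpha,\beta}y=\mathcal D^2\,\mathcal I^{\beta(2-\alpha)}\bigl(u-u(0)-u'(0)\,t\bigr)$ with $u=\mathcal I^{(1-\beta)(2-\alpha)}y$ (derivatives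 at the end points of $[0,T]$ are one-sided). Consider the equation $${}^H\mathcal D^{\alpha,\beta}x(t)=f(t,x(t)),\quad t\in[0,T],\tag{E}$$ the boundary conditions $$x(0)=0,\qquad x(T)=\sum_{i=1}^m\sigma_i\,\mathcal I_{\eta_i}^{\mu_i,\delta_i}x(\xi_i)\tag{B}$$ (the integrals being required to converge), and the problem (E)–(B). Put $$\Delta=T^{\gamma-1}-\sum_{i=1}^m\sigma_i\xi_i^{\gamma-1}\frac{\Gamma(\mu_i+(\gamma-1)/\eta_i+1)}{\Gamma(\mu_i+(\gamma-1)/\eta_i+\delta_i+1)},$$ assume $\Delta\neq0$, and put $$\Omega=\frac1{\Gamma(\alpha+1)}\left(T^\alpha+\frac{T^{\gamma+\alpha-1}}{|\Delta|}+\frac{T^{\gamma-1}}{|\Delta|}\sum_{i=1}^m\frac{|\sigma_i|\,\xi_i^{\alpha}\,\Gamma(\alpha/\eta_i+\mu_i+1)}{\Gamma(\delta_i+\alpha/\eta_i+\mu_i+1)}\right).$$ Theorem. Assume that (H1) $f:[0,T]\times\mathbb R\to\mathbb R$ is continuous, (H2) there is $L>0$ with $|f(t,x)-f(t,y)|\le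 L|x-y|$ for all $t\in[0,T]$, $x,y\in\mathbb R$, and that $L\Omega<1$. Put $C_f=\frac{\Omega}{1-L\Omega}$. Then: (a) The problem (E)–(B) has a unique solution $x\in C([0,T],\mathbb R)$. For every $\epsilon>0$ and every $y\in C([0,T],\mathbb R)$ that satisfies (B) and $$|{}^H\mathcal D^{\alpha,\beta}y(t)-f(t,y(t))|\le\epsilon,\quad t\in[0,T],\tag{I}$$ one has $|y(t)-x(t)|\le C_f\,\epsilon$ for all $t\in[0,T]$. (b) Hence the problem is Ulam–Hyers stable: $C_f>0$, and for every $\epsilon>0$ and every $y\in C([0,T],\mathbb R)$ satisfying (I) and (B) there is a solution $x\in C([0,T],\mathbb R)$ of (E)–(B) with $|y-x|\le C_f\,\epsilon$ on $[0,T]$. It is also generalized Ulam–Hyers stable: there is a continuous $\vartheta_f:[0,\infty)\to[0,\infty)$ with $\vartheta_f(0)=0$ such that the same holds with $\vartheta_f(\epsilon)$ in place of $C_f\,\epsilon$. (c) The equation (E) alone is Ulam–Hyers stable with the same constant $C_f$, and generalized Ulam–Hyers stable: for every $\epsilon>0$ and every $y\in C([0,T],\mathbb R)$ satisfying (I), with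 no boundary condition on $y$, there is a solution $x\in C([0,T],\mathbb R)$ of (E) with $|y-x|\le C_f\,\epsilon$ (respectively $\le\vartheta_f(\epsilon)$) on $[0,T]$. -/

import Mathlib

open Set MeasureTheory

noncomputable section

/-- The Riemann–Liouville fractional integral of order `a ≥ 0` with base point `0`,
`(I^a y)(t) = 1/Γ(a) ∫₀ᵗ (t - s)^(a-1) y(s) ds`, where `I^0` is the identity. -/
def rlIntegral (a : ℝ) (y : ℝ → ℝ) (t : ℝ) : ℝ :=
  if a = 0 then y t
  else 1 / Real.Gamma a * ∫ s in (0 : ℝ)..t, (t - s) ^ (a - 1) * y s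

/-- `HasHilferDeriv α β T y h`: the Hilfer derivative of order `α ∈ (1, 2)` and type `β`
of `y` exists at every point of `[0, T]` and equals `h` there.

The Hilfer derivative is `I^b D² u` with `u = I^a y`, `a = (1 - β)(2 - α)`, `b = β(2 - α)`.
It is taken in the regularised form `D² I^b (u - u(0) - u'(0) t)`: this is the same function
when `u` is twice continuously differentiable, and it needs no second derivative of `u`
when `u` is less regular. For `β = 0` it is the Riemann–Liouville derivative `D² I^(2-α) y`,
and for `β = 1` it is the Caputo derivative in the usual form
`D² I^(2-α) (y - y(0) - y'(0) t)`. Derivatives at the end points are one-sided. -/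
def HasHilferDeriv (α β T : ℝ) (y h : ℝ → ℝ) : Prop :=
  ∃ (u₁ : ℝ) (v : ℝ → ℝ),
    HasDerivWithinAt (rlIntegral ((1 - β) * (2 - α)) y) u₁ (Icc 0 T) 0 ∧
    ∀ t ∈ Icc (0 : ℝ) T,
      HasDerivWithinAt
        (rlIntegral (β * (2 - α)) (fun s =>
          rlIntegral ((1 - β) * (2 - α)) y s - rlIntegral ((1 - β) * (2 - α)) y 0 - u₁ * s))
        (v t) (Icc 0 T) t ∧
      HasDerivWithinAt v (h t) (Icc 0 T) t

/-- The integrand of the Erdélyi–Kober fractional integral. -/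
def ekIntegrand (η μ δ : ℝ) (y : ℝ → ℝ) (t s : ℝ) : ℝ :=
  s ^ (η * μ + η - 1) * y s / (t ^ η - s ^ η) ^ (1 - δ)

/-- The Erdélyi–Kober fractional integral `I_η^{μ,δ} y (t)`. -/
def ekIntegral (η μ δ : ℝ) (y : ℝ → ℝ) (t : ℝ) : ℝ :=
  η * t ^ (-(η * (δ + μ))) / Real.Gamma δ * ∫ s in (0 : ℝ)..t, ekIntegrand η μ δ y t s

/-- The exponent `γ = α + 2β - αβ`. -/
def hilferGamma (α β : ℝ) : ℝ := α + 2 * β - α * β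

/-- The constant `Δ`. -/
def bvpDelta (α β T : ℝ) {m : ℕ} (σ η μ δ ξ : Fin m → ℝ) : ℝ :=
  T ^ (hilferGamma α β - 1) -
    ∑ i, σ i * ξ i ^ (hilferGamma α β - 1) *
      (Real.Gamma (μ i + (hilferGamma α β - 1) / η i + 1) /
        Real.Gamma (μ i + (hilferGamma α β - 1) / η i + δ i + 1))

/-- The constant `Ω`. -/
def bvpOmega (α β T : ℝ) {m : ℕ} (σ η μ δ ξ : Fin m → ℝ) : ℝ :=
  1 / Real.Gamma (α + 1) *
    (T ^ α + T ^ (hilferGamma α β + α - 1) / |bvpDelta α β T σ η μ δ ξ| +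
      T ^ (hilferGamma α β - 1) / |bvpDelta α β T σ η μ δ ξ| *
        ∑ i, |σ i| * ξ i ^ α * Real.Gamma (α / η i + μ i + 1) /
          Real.Gamma (δ i + α / η i + μ i + 1))

/-- The boundary conditions `x(0) = 0` and `x(T) = ∑ σᵢ I_{ηᵢ}^{μᵢ,δᵢ} x(ξᵢ)`, where the
Erdélyi–Kober integrals are required to converge. -/
def BoundaryConditions (T : ℝ) {m : ℕ} (σ η μ δ ξ : Fin m → ℝ) (x : ℝ → ℝ) : Prop :=
  x 0 = 0 ∧
  (∀ i, IntervalIntegrable (ekIntegrand (η i) (μ i) (δ i) x (ξ i)) volume 0 (ξ i)) ∧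
  x T = ∑ i, σ i * ekIntegral (η i) (μ i) (δ i) x (ξ i)

/-- `x ∈ C([0, T], ℝ)` solves the equation `D^{α,β} x(t) = f(t, x(t))` on `[0, T]`. -/
def SolvesEquation (α β T : ℝ) (f : ℝ → ℝ → ℝ) (x : ℝ → ℝ) : Prop :=
  ContinuousOn x (Icc 0 T) ∧ HasHilferDeriv α β T x (fun t => f t (x t))

/-- `y ∈ C([0, T], ℝ)` solves the inequality `|D^{α,β} y(t) - f(t, y(t))| ≤ ε` on `[0, T]`. -/
def SolvesInequality (α β T : ℝ) (f : ℝ → ℝ → ℝ) (ε : ℝ) (y : ℝ → ℝ) : Prop :=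
  ContinuousOn y (Icc 0 T) ∧
  ∃ h : ℝ → ℝ, HasHilferDeriv α β T y h ∧ ∀ t ∈ Icc (0 : ℝ) T, |h t - f t (y t)| ≤ ε

/-- `x` solves the boundary value problem. -/
def SolvesProblem (α β T : ℝ) (f : ℝ → ℝ → ℝ) {m : ℕ} (σ η μ δ ξ : Fin m → ℝ)
    (x : ℝ → ℝ) : Prop :=
  SolvesEquation α β T f x ∧ BoundaryConditions T σ η μ δ ξ x

/-- `y` solves the inequality and satisfies the boundary conditions of the problem. -/
def SolvesPerturbedProblem (α β T : ℝ) (f : ℝ → ℝ → ℝ) {m : ℕ} (σ η μ δ ξ : Fin m → ℝ)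
    (ε : ℝ) (y : ℝ → ℝ) : Prop :=
  SolvesInequality α β T f ε y ∧ BoundaryConditions T σ η μ δ ξ y

/-- Ulam–Hyers stability on `[0, T]` with constant `C > 0`, for the exact solutions `Sol`
and the `ε`-approximate solutions `Approx ε`. -/
def UlamHyersStableWith (T : ℝ) (Sol : (ℝ → ℝ) → Prop) (Approx : ℝ → (ℝ → ℝ) → Prop)
    (C : ℝ) : Prop :=
  0 < C ∧ ∀ ε : ℝ, 0 < ε → ∀ y, Approx ε y →
    ∃ x, Sol x ∧ ∀ t ∈ Icc (0 : ℝ) T, |y t - x t| ≤ C * ε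

/-- Ulam–Hyers stability. -/
def UlamHyersStable (T : ℝ) (Sol : (ℝ → ℝ) → Prop) (Approx : ℝ → (ℝ → ℝ) → Prop) : Prop :=
  ∃ C : ℝ, UlamHyersStableWith T Sol Approx C

/-- Generalized Ulam–Hyers stability: `C ε` is replaced by `θ(ε)` for a continuous
`θ : [0, ∞) → [0, ∞)` with `θ(0) = 0`. -/
def GeneralizedUlamHyersStable (T : ℝ) (Sol : (ℝ → ℝ) → Prop)
    (Approx : ℝ → (ℝ → ℝ) → Prop) : Prop :=
  ∃ θ : ℝ → ℝ, ContinuousOn θ (Ici 0) ∧ (∀ r, 0 ≤ r → 0 ≤ θ r) ∧ θ 0 = 0 ∧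
    ∀ ε : ℝ, 0 < ε → ∀ y, Approx ε y →
      ∃ x, Sol x ∧ ∀ t ∈ Icc (0 : ℝ) T, |y t - x t| ≤ θ ε

end

open Set MeasureTheory Filter Topology
open scoped Convolution

noncomputable section

/-! ### The beta integral on `[0, t]` -/

/-! Put a = (1 - β)(2 - α) and b = β(2 - α), so a + b = 2 - α and γ - 1 = 1 - a. A continuous y
whose Hilfer derivative is a bounded h has the form y = c₀ + c t^(γ-1) + I^α h, with c₀ = 0 unless a
= 0 (`HasHilferDeriv.exists_eq`); `hasHilferDeriv_of_eq` is the converse for continuous h. Both rest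
on the semigroup law I^a I^b = I^(a+b), which is associativity of convolution plus the beta
integral, and the first also on injectivity of I^a for 0 ≤ a ≤ 1.

Erdélyi–Kober integrals multiply powers by a Gamma quotient, so (B) forces c₀ = 0 and becomes one
linear equation for c with leading coefficient Δ (`boundaryConditions_iff`). Hence y = `bvpOp` h, a
linear operator of sup-norm at most Ω (`abs_bvpOp_le`).

Since LΩ < 1, the map x ↦ `bvpOp` (f(·, x)) is a contraction, which gives existence. If x is exact,
y is approximate and D = max |x - y|, then D ≤ Ω(LD + ε), which gives C_f, and uniqueness at ε = 0.
For the equation alone, y has free coefficients; a fixed point of x ↦ y + `bvpOp` (f(·, x) - H),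
where H is the derivative of y, keeps x - y in the range of `bvpOp`, so the same estimate applies.
-/

theorem integral_rpow_mul_sub_rpow {u v t : ℝ} (hu : 0 < u) (hv : 0 < v) (ht : 0 < t) :
    ∫ s in (0 : ℝ)..t, s ^ (u - 1) * (t - s) ^ (v - 1) =
      t ^ (u + v - 1) * (Real.Gamma u * Real.Gamma v / Real.Gamma (u + v)) := by
  have h := Complex.betaIntegral_scaled u v ht
  rw [Complex.betaIntegral_eq_Gamma_mul_div _ _ (by simpa) (by simpa)] at h
  have h2 : ∫ s in (0 : ℝ)..t, (s : ℂ) ^ ((u : ℂ) - 1) * ((t : ℂ) - s) ^ ((v : ℂ) - 1) =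
      ((∫ s in (0 : ℝ)..t, s ^ (u - 1) * (t - s) ^ (v - 1) : ℝ) : ℂ) := by
    rw [← intervalIntegral.integral_ofReal]
    refine intervalIntegral.integral_congr fun s hs => ?_
    rw [uIcc_of_le ht.le] at hs
    rw [Complex.ofReal_mul, Complex.ofReal_cpow hs.1, Complex.ofReal_cpow (by linarith [hs.2])]
    push_cast
    rfl
  rw [h2, ← Complex.ofReal_add, Complex.Gamma_ofReal, Complex.Gamma_ofReal, Complex.Gamma_ofReal,
    ← Complex.ofReal_one, ← Complex.ofReal_sub, ← Complex.ofReal_cpow ht.le] at h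
  exact_mod_cast h

/-- A non-integrable function has integral 0 by convention, whereas the beta integral is positive.
-/
theorem intervalIntegrable_rpow_mul_sub_rpow {u v t : ℝ} (hu : 0 < u) (hv : 0 < v) (ht : 0 < t) :
    IntervalIntegrable (fun s => s ^ (u - 1) * (t - s) ^ (v - 1)) volume 0 t := by
  by_contra h
  have h1 := intervalIntegral.integral_undef h
  rw [integral_rpow_mul_sub_rpow hu hv ht] at h1
  have := Real.Gamma_pos_of_pos hu
  have := Real.Gamma_pos_of_pos hv
  have := Real.Gamma_pos_of_pos (add_pos hu hv)
  have : 0 < t ^ (u + v - 1) * (Real.Gamma u * Real.Gamma v / Real.Gamma (u + v)) := by positivity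
  exact this.ne' h1

theorem intervalIntegrable_sub_rpow {a t : ℝ} (ha : 0 < a) (ht : 0 ≤ t) :
    IntervalIntegrable (fun s => (t - s) ^ (a - 1)) volume 0 t := by
  rcases ht.eq_or_lt with rfl | ht
  · simp
  · simpa using intervalIntegrable_rpow_mul_sub_rpow one_pos ha ht

/-! ### Elementary properties of the Riemann–Liouville integral -/

theorem rlIntegral_zero_left (y : ℝ → ℝ) : rlIntegral 0 y = y := by
  ext t; simp [rlIntegral]

theorem rlIntegral_of_ne {a : ℝ} (ha : a ≠ 0) (y : ℝ → ℝ) (t : ℝ) :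
    rlIntegral a y t = 1 / Real.Gamma a * ∫ s in (0 : ℝ)..t, (t - s) ^ (a - 1) * y s := by
  simp [rlIntegral, ha]

theorem rlIntegral_apply_zero {a : ℝ} (ha : a ≠ 0) (y : ℝ → ℝ) : rlIntegral a y 0 = 0 := by
  simp [rlIntegral, ha]

theorem rlIntegral_one (y : ℝ → ℝ) (t : ℝ) : rlIntegral 1 y t = ∫ s in (0 : ℝ)..t, y s := by
  simp [rlIntegral]

theorem rlIntegral_congr {a t : ℝ} {y z : ℝ → ℝ} (ht : 0 ≤ t) (h : EqOn y z (Icc 0 t)) :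
    rlIntegral a y t = rlIntegral a z t := by
  unfold rlIntegral
  split_ifs
  · exact h ⟨ht, le_rfl⟩
  · congr 1
    refine intervalIntegral.integral_congr fun s hs => ?_
    rw [uIcc_of_le ht] at hs
    simp only [h hs]

theorem rlIntegral_congr_Ioo {a t : ℝ} {y z : ℝ → ℝ} (ha : a ≠ 0) (ht : 0 ≤ t)
    (h : EqOn y z (Ioo 0 t)) : rlIntegral a y t = rlIntegral a z t := by
  rw [rlIntegral_of_ne ha, rlIntegral_of_ne ha, intervalIntegral.integral_of_le ht,
    intervalIntegral.integral_of_le ht, integral_Ioc_eq_integral_Ioo, integral_Ioc_eq_integral_Ioo]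
  congr 1
  refine setIntegral_congr_fun measurableSet_Ioo fun s hs => ?_
  simp only [h hs]

theorem intervalIntegrable_rlIntegrand {a t M : ℝ} {y : ℝ → ℝ} (ha : 0 < a) (ht : 0 ≤ t)
    (hy : Measurable y) (hM : ∀ s ∈ Ioo 0 t, |y s| ≤ M) :
    IntervalIntegrable (fun s => (t - s) ^ (a - 1) * y s) volume 0 t := by
  have h := intervalIntegrable_sub_rpow ha ht
  rw [intervalIntegrable_iff_integrableOn_Ioo_of_le ht] at h ⊢
  refine h.mul_bdd (c := M) hy.aestronglyMeasurable ?_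
  exact (ae_restrict_iff' measurableSet_Ioo).2 (.of_forall fun s hs => hM s hs)

theorem rlIntegral_rpow {a p t : ℝ} (ha : 0 ≤ a) (hp : 0 ≤ p) (ht : 0 ≤ t) :
    rlIntegral a (fun s => s ^ p) t =
      Real.Gamma (p + 1) / Real.Gamma (a + p + 1) * t ^ (a + p) := by
  have hp1 := Real.Gamma_pos_of_pos (show 0 < p + 1 by linarith)
  rcases ha.eq_or_lt with rfl | ha
  · rw [rlIntegral_zero_left, zero_add, div_self hp1.ne', one_mul]
  rcases ht.eq_or_lt with rfl | ht
  · rw [rlIntegral_apply_zero ha.ne', Real.zero_rpow (by linarith), mul_zero]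
  rw [rlIntegral_of_ne ha.ne']
  have := integral_rpow_mul_sub_rpow (show 0 < p + 1 by linarith) ha ht
  simp only [add_sub_cancel_right] at this
  simp_rw [mul_comm _ (_ ^ p)]
  rw [this, show p + 1 + a - 1 = a + p by ring, show p + 1 + a = a + p + 1 by ring]
  have := Real.Gamma_pos_of_pos ha
  field_simp

theorem rlIntegral_const {a c t : ℝ} (ha : 0 ≤ a) (ht : 0 ≤ t) :
    rlIntegral a (fun _ => c) t = c * (t ^ a / Real.Gamma (a + 1)) := by
  rcases ha.eq_or_lt with rfl | ha
  · simp [rlIntegral_zero_left]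
  have h := rlIntegral_rpow ha.le le_rfl ht
  simp only [Real.rpow_zero, zero_add, Real.Gamma_one, add_zero, rlIntegral_of_ne ha.ne'] at h ⊢
  rw [intervalIntegral.integral_mul_const, ← mul_assoc]
  simp only [mul_one] at h
  rw [h]; ring

theorem rlIntegral_add {a t M N : ℝ} {y z : ℝ → ℝ} (ha : 0 ≤ a) (ht : 0 ≤ t)
    (hy : Measurable y) (hM : ∀ s ∈ Ioo 0 t, |y s| ≤ M)
    (hz : Measurable z) (hN : ∀ s ∈ Ioo 0 t, |z s| ≤ N) :
    rlIntegral a (fun s => y s + z s) t = rlIntegral a y t + rlIntegral a z t := by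
  rcases ha.eq_or_lt with rfl | ha
  · simp [rlIntegral_zero_left]
  simp only [rlIntegral_of_ne ha.ne', mul_add]
  rw [intervalIntegral.integral_add (intervalIntegrable_rlIntegrand ha ht hy hM)
    (intervalIntegrable_rlIntegrand ha ht hz hN), mul_add]

theorem rlIntegral_const_mul (a c t : ℝ) (y : ℝ → ℝ) :
    rlIntegral a (fun s => c * y s) t = c * rlIntegral a y t := by
  unfold rlIntegral
  split_ifs
  · rfl
  · simp_rw [mul_left_comm _ c]
    rw [intervalIntegral.integral_const_mul]
    ring

theorem rlIntegral_sub {a t M N : ℝ} {y z : ℝ → ℝ} (ha : 0 ≤ a) (ht : 0 ≤ t)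
    (hy : Measurable y) (hM : ∀ s ∈ Ioo 0 t, |y s| ≤ M)
    (hz : Measurable z) (hN : ∀ s ∈ Ioo 0 t, |z s| ≤ N) :
    rlIntegral a (fun s => y s - z s) t = rlIntegral a y t - rlIntegral a z t := by
  have h := rlIntegral_add ha ht hy hM (hz.const_mul (-1)) (N := N)
    (fun s hs => by simpa using hN s hs)
  rw [rlIntegral_const_mul] at h
  simpa [sub_eq_add_neg] using h

theorem abs_rlIntegral_le {a t M : ℝ} {y : ℝ → ℝ} (ha : 0 ≤ a) (ht : 0 ≤ t)
    (hM : ∀ s ∈ Icc 0 t, |y s| ≤ M) :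
    |rlIntegral a y t| ≤ M * (t ^ a / Real.Gamma (a + 1)) := by
  rcases ha.eq_or_lt with rfl | ha
  · simpa [rlIntegral_zero_left] using hM t ⟨ht, le_rfl⟩
  rw [← rlIntegral_const ha.le ht, rlIntegral_of_ne ha.ne', rlIntegral_of_ne ha.ne', abs_mul]
  have hG := Real.Gamma_pos_of_pos ha
  rw [abs_of_pos (show 0 < 1 / Real.Gamma a by positivity)]
  gcongr
  rw [← Real.norm_eq_abs]
  refine intervalIntegral.norm_integral_le_of_norm_le ht (.of_forall fun s hs => ?_)
    ((intervalIntegrable_sub_rpow ha ht).mul_const M)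
  have h0 : 0 ≤ (t - s) ^ (a - 1) := Real.rpow_nonneg (by linarith [hs.2]) _
  rw [Real.norm_eq_abs, abs_mul, abs_of_nonneg h0]
  exact mul_le_mul_of_nonneg_left (hM s ⟨hs.1.le, hs.2⟩) h0

/-! ### Continuity -/

/-- The substitution s = t r removes t from the limits and from the singular kernel, so that
continuity in t follows by dominated convergence. -/
theorem rlIntegral_eq_rpow_mul {a t : ℝ} (ha : 0 < a) (ht : 0 ≤ t) (y : ℝ → ℝ) :
    rlIntegral a y t =
      1 / Real.Gamma a * (t ^ a * ∫ r in (0 : ℝ)..1, (1 - r) ^ (a - 1) * y (t * r)) := by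
  rw [rlIntegral_of_ne ha.ne']
  congr 1
  rcases ht.eq_or_lt with rfl | ht
  · simp [Real.zero_rpow ha.ne']
  have h := intervalIntegral.mul_integral_comp_mul_left (a := 0) (b := 1) (c := t)
    (f := fun s => (t - s) ^ (a - 1) * y s)
  rw [mul_zero, mul_one] at h
  rw [← h, show t ^ a = t * t ^ (a - 1) by
    rw [mul_comm, Real.rpow_sub_one ht.ne']; field_simp, mul_assoc,
    ← intervalIntegral.integral_const_mul (t ^ (a - 1))]
  congr 1
  refine intervalIntegral.integral_congr fun r hr => ?_
  rw [uIcc_of_le zero_le_one] at hr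
  rw [← mul_assoc, ← Real.mul_rpow ht.le (by linarith [hr.2])]
  congr 3
  ring

/-- Extension by the end values, through the projection onto `[0, T]`. -/
theorem exists_continuous_bounded_eqOn {T : ℝ} {y : ℝ → ℝ} (hT : 0 ≤ T)
    (hy : ContinuousOn y (Icc 0 T)) :
    ∃ (z : ℝ → ℝ) (M : ℝ), Continuous z ∧ (∀ s, |z s| ≤ M) ∧ EqOn y z (Icc 0 T) := by
  obtain ⟨M, hM⟩ := isCompact_Icc.exists_bound_of_continuousOn hy
  refine ⟨fun s => y (projIcc 0 T hT s), M, ?_, fun s => hM _ (projIcc 0 T hT s).2, fun s hs => ?_⟩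
  · exact hy.comp_continuous (continuous_subtype_val.comp continuous_projIcc)
      fun s => (projIcc 0 T hT s).2
  · simp [projIcc_of_mem hT hs]

theorem continuousOn_rlIntegral {a T : ℝ} {y : ℝ → ℝ} (ha : 0 ≤ a) (hT : 0 ≤ T)
    (hy : ContinuousOn y (Icc 0 T)) : ContinuousOn (rlIntegral a y) (Icc 0 T) := by
  rcases ha.eq_or_lt with rfl | ha
  · rwa [rlIntegral_zero_left]
  obtain ⟨z, M, hzc, hzM, hyz⟩ := exists_continuous_bounded_eqOn hT hy
  have hc : Continuous fun t => 1 / Real.Gamma a *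
      (t ^ a * ∫ r in (0 : ℝ)..1, (1 - r) ^ (a - 1) * z (t * r)) := by
    refine continuous_const.mul ((Real.continuous_rpow_const ha.le).mul ?_)
    refine intervalIntegral.continuous_of_dominated_interval
      (bound := fun r => |(1 - r) ^ (a - 1)| * M) (fun t => ?_) (fun t => ?_) ?_ ?_
    · exact (Measurable.mul (by fun_prop) (by fun_prop)).aestronglyMeasurable
    · refine .of_forall fun r _ => ?_
      rw [norm_mul]
      exact mul_le_mul_of_nonneg_left (hzM _) (norm_nonneg _)
    · exact (intervalIntegrable_sub_rpow ha zero_le_one).abs.mul_const M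
    · exact .of_forall fun r _ => by fun_prop
  refine hc.continuousOn.congr fun t ht => ?_
  beta_reduce
  rw [← rlIntegral_eq_rpow_mul ha ht.1]
  exact rlIntegral_congr ht.1 (hyz.mono (Icc_subset_Icc_right ht.2))

/-! ### The semigroup property -/

/-- For functions vanishing on `(-∞, 0]` only the values on `(0, t)` enter the convolution at t. For
the same reason the cut-off of `rlKernel` at T is harmless for t ≤ T. -/
theorem convolution_eq_intervalIntegral {t : ℝ} {F G f g : ℝ → ℝ} (ht : 0 ≤ t)
    (hF : EqOn F f (Ioo 0 t)) (hG : EqOn G g (Ioo 0 t))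
    (hF0 : ∀ s ≤ 0, F s = 0) (hG0 : ∀ s ≤ 0, G s = 0) :
    (F ⋆[ContinuousLinearMap.mul ℝ ℝ] G) t = ∫ s in (0 : ℝ)..t, f s * g (t - s) := by
  rw [intervalIntegral.integral_of_le ht, integral_Ioc_eq_integral_Ioo, convolution_def]
  rw [← setIntegral_eq_integral_of_forall_compl_eq_zero (s := Ioo 0 t)]
  · refine setIntegral_congr_fun measurableSet_Ioo fun s hs => ?_
    simp [hF hs, hG (show t - s ∈ Ioo 0 t from ⟨by linarith [hs.2], by linarith [hs.1]⟩)]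
  · intro s hs
    by_cases h : s ≤ 0
    · simp [hF0 s h]
    · simp [hG0 (t - s) (by
        by_contra! h'
        exact hs ⟨not_le.1 h, by linarith⟩)]

/-- The kernel of the Riemann–Liouville integral, cut off at `T`. -/
def rlKernel (a T : ℝ) : ℝ → ℝ :=
  (Ioc 0 T).indicator fun s => 1 / Real.Gamma a * s ^ (a - 1)

theorem integrable_rlKernel {a T : ℝ} (ha : 0 < a) (hT : 0 ≤ T) : Integrable (rlKernel a T) := by
  unfold rlKernel
  rw [integrable_indicator_iff measurableSet_Ioc, ← intervalIntegrable_iff_integrableOn_Ioc_of_le hT]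
  exact (intervalIntegral.intervalIntegrable_rpow' (by linarith)).const_mul _

theorem rlIntegral_eq_convolution {a t T : ℝ} {y Y : ℝ → ℝ} (ha : 0 < a) (ht : 0 ≤ t) (htT : t ≤ T)
    (hY : EqOn Y y (Ioo 0 t)) (hY0 : ∀ s ≤ 0, Y s = 0) :
    (rlKernel a T ⋆[ContinuousLinearMap.mul ℝ ℝ] Y) t = rlIntegral a y t := by
  rw [convolution_eq_intervalIntegral (f := fun s => 1 / Real.Gamma a * s ^ (a - 1)) ht ?_ hY ?_ hY0,
    rlIntegral_of_ne ha.ne', ← intervalIntegral.integral_const_mul]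
  · have := intervalIntegral.integral_comp_sub_left (a := 0) (b := t)
      (fun s => 1 / Real.Gamma a * s ^ (a - 1) * y (t - s)) t
    simp only [sub_self, sub_zero, sub_sub_cancel] at this
    rw [← this]
    simp only [mul_assoc]
  · intro s hs
    exact indicator_of_mem (show s ∈ Ioc 0 T from ⟨hs.1, hs.2.le.trans htT⟩) _
  · intro s hs
    exact indicator_of_notMem (fun h => not_lt.2 hs h.1) _

/-- The beta integral says that the kernels themselves form a convolution semigroup. -/
theorem rlKernel_convolution {a b t T : ℝ} (ha : 0 < a) (hb : 0 < b) (ht : 0 < t) (htT : t ≤ T) :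
    (rlKernel a T ⋆[ContinuousLinearMap.mul ℝ ℝ] rlKernel b T) t =
      1 / Real.Gamma (a + b) * t ^ (a + b - 1) := by
  rw [convolution_eq_intervalIntegral (f := fun s => 1 / Real.Gamma a * s ^ (a - 1))
    (g := fun s => 1 / Real.Gamma b * s ^ (b - 1)) ht.le]
  · have h := integral_rpow_mul_sub_rpow ha hb ht
    have h2 : ∀ s, 1 / Real.Gamma a * s ^ (a - 1) * (1 / Real.Gamma b * (t - s) ^ (b - 1)) =
        1 / Real.Gamma a * (1 / Real.Gamma b) * (s ^ (a - 1) * (t - s) ^ (b - 1)) := by intro; ring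
    simp_rw [h2]
    rw [intervalIntegral.integral_const_mul, h]
    have := (Real.Gamma_pos_of_pos ha).ne'
    have := (Real.Gamma_pos_of_pos hb).ne'
    field_simp
  · intro s hs
    exact indicator_of_mem (show s ∈ Ioc 0 T from ⟨hs.1, hs.2.le.trans htT⟩) _
  · intro s hs
    exact indicator_of_mem (show s ∈ Ioc 0 T from ⟨hs.1, hs.2.le.trans htT⟩) _
  · intro s hs
    exact indicator_of_notMem (fun h => not_lt.2 hs h.1) _
  · intro s hs
    exact indicator_of_notMem (fun h => not_lt.2 hs h.1) _

theorem convolution_eq_zero_of_nonpos {t : ℝ} {F G : ℝ → ℝ} (ht : t ≤ 0)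
    (hF0 : ∀ s ≤ 0, F s = 0) (hG0 : ∀ s ≤ 0, G s = 0) :
    (F ⋆[ContinuousLinearMap.mul ℝ ℝ] G) t = 0 := by
  rw [convolution_def]
  refine integral_eq_zero_of_ae (.of_forall fun s => ?_)
  by_cases h : s ≤ 0
  · simp [hF0 s h]
  · simp [hG0 (t - s) (by linarith)]

/-- Associativity of convolution for the two kernels and y cut off to `(0, t]`. -/
theorem rlIntegral_rlIntegral {a b t M : ℝ} {y : ℝ → ℝ} (ha : 0 ≤ a) (hb : 0 < b) (ht : 0 ≤ t)
    (hy : Measurable y) (hM : ∀ s ∈ Icc 0 t, |y s| ≤ M) :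
    rlIntegral a (rlIntegral b y) t = rlIntegral (a + b) y t := by
  rcases ha.eq_or_lt with rfl | ha
  · rw [rlIntegral_zero_left, zero_add]
  rcases ht.eq_or_lt with rfl | htp
  · rw [rlIntegral_apply_zero ha.ne', rlIntegral_apply_zero (by positivity)]
  have hM0 : 0 ≤ M := (abs_nonneg _).trans (hM t ⟨ht, le_rfl⟩)
  set Y := (Ioc 0 t).indicator y with hY
  have hYM : ∀ s, |Y s| ≤ M := by
    intro s
    by_cases h : s ∈ Ioc 0 t
    · rw [hY, indicator_of_mem h]; exact hM s ⟨h.1.le, h.2⟩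
    · rw [hY, indicator_of_notMem h]; simpa
  have hYi : Integrable Y := by
    rw [hY, integrable_indicator_iff measurableSet_Ioc]
    refine Integrable.of_bound hy.aestronglyMeasurable M ?_
    exact (ae_restrict_iff' measurableSet_Ioc).2 (.of_forall fun s hs => hM s ⟨hs.1.le, hs.2⟩)
  have hYy : ∀ r ≤ t, EqOn Y y (Ioo 0 r) := fun r hr s hs =>
    indicator_of_mem (show s ∈ Ioc 0 t from ⟨hs.1, hs.2.le.trans hr⟩) _
  have hY0 : ∀ s ≤ 0, Y s = 0 := fun s hs => indicator_of_notMem (fun h => not_lt.2 hs h.1) _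
  have hK0 : ∀ c, ∀ s ≤ 0, rlKernel c t s = 0 := fun c s hs =>
    indicator_of_notMem (fun h => not_lt.2 hs h.1) _
  have hKa := integrable_rlKernel ha ht
  have hKb := integrable_rlKernel hb ht
  have key : ((rlKernel a t ⋆[ContinuousLinearMap.mul ℝ ℝ] rlKernel b t)
      ⋆[ContinuousLinearMap.mul ℝ ℝ] Y) t = (rlKernel a t ⋆[ContinuousLinearMap.mul ℝ ℝ]
      (rlKernel b t ⋆[ContinuousLinearMap.mul ℝ ℝ] Y)) t := by
    refine convolution_assoc _ _ _ _ (fun x y z => by simp [mul_assoc]) hKa.aestronglyMeasurable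
      hKb.aestronglyMeasurable hYi.aestronglyMeasurable ?_ ?_ ?_
    · exact Integrable.ae_convolution_exists _ hKa hKb
    · exact Integrable.ae_convolution_exists _ hKb.norm hYi.norm
    -- Almost everywhere existence is not enough here: the outer convolution must exist at t itself.
    -- It does, because the inner one is bounded by ‖k_b‖₁ M and k_a is integrable.
    · have hC := Integrable.integrable_convolution (ContinuousLinearMap.mul ℝ ℝ) hKb.norm hYi.norm
      refine BddAbove.convolutionExistsAt (ContinuousLinearMap.mul ℝ ℝ) (s := univ) ?_ .univ (subset_univ _)
        hKa.norm.integrableOn hC.aestronglyMeasurable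
      refine ⟨(∫ s, ‖rlKernel b t s‖) * M, ?_⟩
      rintro _ ⟨x, -, rfl⟩
      beta_reduce
      rw [convolution_def, ← integral_mul_const]
      refine norm_integral_le_of_norm_le (hKb.norm.mul_const M) (.of_forall fun s => ?_)
      simp only [ContinuousLinearMap.mul_apply', norm_mul, norm_norm]
      exact mul_le_mul_of_nonneg_left (hYM _) (norm_nonneg _)
  rw [rlIntegral_eq_convolution ha ht le_rfl (y := rlIntegral b y)
    (fun s hs => rlIntegral_eq_convolution hb hs.1.le hs.2.le (hYy s hs.2.le) hY0)
    fun s hs => convolution_eq_zero_of_nonpos hs (hK0 b) hY0] at key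
  rw [← key, convolution_eq_intervalIntegral
    (f := fun s => 1 / Real.Gamma (a + b) * s ^ (a + b - 1)) ht
    (fun s hs => rlKernel_convolution ha hb hs.1 hs.2.le) (hYy t le_rfl)
    (fun s hs => convolution_eq_zero_of_nonpos hs (hK0 a) (hK0 b)) hY0,
    rlIntegral_of_ne (by positivity), ← intervalIntegral.integral_const_mul]
  have := intervalIntegral.integral_comp_sub_left (a := 0) (b := t)
      (fun s => 1 / Real.Gamma (a + b) * s ^ (a + b - 1) * y (t - s)) t
  simp only [sub_self, sub_zero, sub_sub_cancel] at this
  rw [← this]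
  simp only [mul_assoc]

/-! ### Continuous arguments, and injectivity -/

theorem rlIntegral_add_of_continuousOn {a t T : ℝ} {y z : ℝ → ℝ} (ha : 0 ≤ a) (ht : t ∈ Icc 0 T)
    (hy : ContinuousOn y (Icc 0 T)) (hz : ContinuousOn z (Icc 0 T)) :
    rlIntegral a (fun s => y s + z s) t = rlIntegral a y t + rlIntegral a z t := by
  have hT : 0 ≤ T := ht.1.trans ht.2
  obtain ⟨y', M, hyc, hyM, hyy⟩ := exists_continuous_bounded_eqOn hT hy
  obtain ⟨z', N, hzc, hzN, hzz⟩ := exists_continuous_bounded_eqOn hT hz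
  have hs : Icc 0 t ⊆ Icc 0 T := Icc_subset_Icc_right ht.2
  rw [rlIntegral_congr ht.1 (hyy.mono hs), rlIntegral_congr ht.1 (hzz.mono hs),
    ← rlIntegral_add ha ht.1 hyc.measurable (fun s _ => hyM s) hzc.measurable fun s _ => hzN s]
  exact rlIntegral_congr ht.1 fun s h => by simp only [hyy (hs h), hzz (hs h)]

theorem rlIntegral_rlIntegral_of_continuousOn {a b t T : ℝ} {y : ℝ → ℝ} (ha : 0 ≤ a) (hb : 0 ≤ b)
    (ht : t ∈ Icc 0 T) (hy : ContinuousOn y (Icc 0 T)) :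
    rlIntegral a (rlIntegral b y) t = rlIntegral (a + b) y t := by
  rcases hb.eq_or_lt with rfl | hb
  · rw [rlIntegral_zero_left, add_zero]
  obtain ⟨z, M, hzc, hzM, hyz⟩ := exists_continuous_bounded_eqOn (ht.1.trans ht.2) hy
  have hs : Icc 0 t ⊆ Icc 0 T := Icc_subset_Icc_right ht.2
  rw [rlIntegral_congr ht.1 (hyz.mono hs),
    ← rlIntegral_rlIntegral ha hb ht.1 hzc.measurable fun s _ => hzM s]
  exact rlIntegral_congr ht.1 fun s h =>
    rlIntegral_congr h.1 (hyz.mono (Icc_subset_Icc_right (h.2.trans ht.2)))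

theorem hasDerivWithinAt_rlIntegral_one {t T : ℝ} {y : ℝ → ℝ} (hy : ContinuousOn y (Icc 0 T))
    (ht : t ∈ Icc 0 T) : HasDerivWithinAt (rlIntegral 1 y) (y t) (Icc 0 T) t := by
  obtain ⟨z, M, hzc, hzM, hyz⟩ := exists_continuous_bounded_eqOn (ht.1.trans ht.2) hy
  rw [hyz ht]
  refine (hzc.integral_hasStrictDerivAt 0 t).hasDerivAt.hasDerivWithinAt.congr_of_mem (fun s hs => ?_) ht
  rw [← rlIntegral_one]
  exact rlIntegral_congr hs.1 (hyz.mono (Icc_subset_Icc_right hs.2))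

/-- Applying I^(1-a) turns the hypothesis into equality of I^1 y and I^1 z, which can be
differentiated. -/
theorem eqOn_of_rlIntegral_eqOn {a T : ℝ} {y z : ℝ → ℝ} (ha0 : 0 ≤ a) (ha1 : a ≤ 1) (hT : 0 < T)
    (hy : ContinuousOn y (Icc 0 T)) (hz : ContinuousOn z (Icc 0 T))
    (h : EqOn (rlIntegral a y) (rlIntegral a z) (Icc 0 T)) : EqOn y z (Icc 0 T) := by
  have h1 : EqOn (rlIntegral 1 y) (rlIntegral 1 z) (Icc 0 T) := fun t ht => by
    have hy' := rlIntegral_rlIntegral_of_continuousOn (sub_nonneg.2 ha1) ha0 ht hy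
    have hz' := rlIntegral_rlIntegral_of_continuousOn (sub_nonneg.2 ha1) ha0 ht hz
    rw [sub_add_cancel] at hy' hz'
    rw [← hy', ← hz']
    exact rlIntegral_congr ht.1 (h.mono (Icc_subset_Icc_right ht.2))
  intro t ht
  have hd := (hasDerivWithinAt_rlIntegral_one hy ht).congr_of_mem h1.symm ht
  exact (uniqueDiffOn_Icc hT t ht).eq_deriv _ hd (hasDerivWithinAt_rlIntegral_one hz ht)

theorem intervalIntegrable_of_abs_le {H : ℝ → ℝ} {M : ℝ} (hH : Measurable H) (hM : ∀ s, |H s| ≤ M)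
    (a b : ℝ) : IntervalIntegrable H volume a b := by
  refine (intervalIntegrable_const (c := M)).mono_fun hH.aestronglyMeasurable (.of_forall fun s => ?_)
  exact (hM s).trans (le_abs_self M)

theorem continuous_rlIntegral_one {H : ℝ → ℝ} {M : ℝ} (hH : Measurable H) (hM : ∀ s, |H s| ≤ M) :
    Continuous (rlIntegral 1 H) := by
  refine (intervalIntegral.continuous_primitive (f := H) (intervalIntegrable_of_abs_le hH hM) 0).congr
    fun t => (rlIntegral_one H t).symm

/-- I^a H = I^(a-1) (I^1 H), and I^1 H is continuous even when H is only bounded and measurable. -/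
theorem continuousOn_rlIntegral_of_one_le {a T M : ℝ} {H : ℝ → ℝ} (ha : 1 ≤ a) (hT : 0 ≤ T)
    (hH : Measurable H) (hM : ∀ s, |H s| ≤ M) : ContinuousOn (rlIntegral a H) (Icc 0 T) := by
  refine (continuousOn_rlIntegral (sub_nonneg.2 ha) hT
    (continuous_rlIntegral_one hH hM).continuousOn).congr fun t ht => ?_
  rw [rlIntegral_rlIntegral (sub_nonneg.2 ha) one_pos ht.1 hH fun s _ => hM s, sub_add_cancel]

theorem hasDerivWithinAt_zero_of_le_rpow {g : ℝ → ℝ} {C p T : ℝ} (hp : 1 < p)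
    (hg : ∀ t ∈ Icc 0 T, |g t| ≤ C * t ^ p) (hT : 0 ≤ T) :
    HasDerivWithinAt g 0 (Icc 0 T) 0 := by
  have h0 : g 0 = 0 := by
    have := hg 0 ⟨le_rfl, hT⟩
    rwa [Real.zero_rpow (by linarith), mul_zero, abs_nonpos_iff] at this
  rw [hasDerivWithinAt_iff_isLittleO, Asymptotics.isLittleO_iff]
  intro ε hε
  have hlim : Tendsto (fun t : ℝ => C * t ^ (p - 1)) (𝓝[Icc 0 T] 0) (𝓝 (C * (0 : ℝ) ^ (p - 1))) :=
    ((continuous_const.mul (Real.continuous_rpow_const (by linarith))).tendsto 0).mono_left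
      nhdsWithin_le_nhds
  rw [Real.zero_rpow (by linarith), mul_zero] at hlim
  filter_upwards [hlim.eventually (gt_mem_nhds hε), self_mem_nhdsWithin] with t ht htI
  simp only [h0, sub_zero, smul_eq_mul, mul_zero, Real.norm_eq_abs]
  refine (hg t htI).trans ?_
  rw [abs_of_nonneg htI.1]
  rcases htI.1.eq_or_lt with rfl | htp
  · simp [Real.zero_rpow (show p ≠ 0 by linarith)]
  · rw [← sub_add_cancel p 1, Real.rpow_add_one htp.ne', ← mul_assoc]
    exact mul_le_mul_of_nonneg_right (by simpa using ht.le) htI.1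

/-- If |g| ≤ ε s near 0, then I^b g is at most ε t times a bounded factor. This yields the initial
value v(0) = 0 for the first derivative in `HasHilferDeriv`. -/
theorem rlIntegral_hasDerivWithinAt_zero {b T : ℝ} {g : ℝ → ℝ} (hb : 0 ≤ b) (hT : 0 < T)
    (h0 : g 0 = 0) (hg : HasDerivWithinAt g 0 (Icc 0 T) 0) :
    HasDerivWithinAt (rlIntegral b g) 0 (Icc 0 T) 0 := by
  have hG := Real.Gamma_pos_of_pos (show 0 < b + 1 by linarith)
  have hI0 : rlIntegral b g 0 = 0 := by
    rcases hb.eq_or_lt with rfl | hb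
    · rwa [rlIntegral_zero_left]
    · exact rlIntegral_apply_zero hb.ne' g
  rw [hasDerivWithinAt_iff_isLittleO, Asymptotics.isLittleO_iff] at hg ⊢
  intro ε hε
  set K := T ^ b / Real.Gamma (b + 1) with hK
  have hKp : 0 < K := by positivity
  obtain ⟨d, hd, hd'⟩ := Metric.mem_nhdsWithin_iff.1 (hg (div_pos hε hKp))
  refine Metric.mem_nhdsWithin_iff.2 ⟨d, hd, fun t ht => ?_⟩
  obtain ⟨htd, ht0, htT⟩ := ht
  simp only [mem_ball_zero_iff, Real.norm_eq_abs, abs_of_nonneg ht0] at htd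
  have hbound : ∀ s ∈ Icc 0 t, |g s| ≤ ε / K * t := fun s hs => by
    have h1 : s ∈ Metric.ball 0 d ∩ Icc 0 T := by
      refine ⟨?_, hs.1, hs.2.trans htT⟩
      simpa [abs_of_nonneg hs.1] using hs.2.trans_lt htd
    have h2 := hd' h1
    simp only [mem_ofPred_eq, h0, sub_zero, smul_eq_mul, mul_zero, Real.norm_eq_abs,
      abs_of_nonneg hs.1] at h2
    exact h2.trans (mul_le_mul_of_nonneg_left hs.2 (by positivity))
  have h3 := abs_rlIntegral_le hb ht0 hbound
  simp only [mem_ofPred_eq, hI0, sub_zero, smul_eq_mul, mul_zero, Real.norm_eq_abs,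
    abs_of_nonneg ht0]
  refine h3.trans ?_
  have h4 : t ^ b / Real.Gamma (b + 1) ≤ K := by
    rw [hK]; gcongr
  calc ε / K * t * (t ^ b / Real.Gamma (b + 1)) ≤ ε / K * t * K := by gcongr
    _ = ε * t := by field_simp

/-! ### Functions with a Hilfer derivative -/

/-- I^a multiplies a constant by t^a / Γ(a + 1), so a nonzero c₀ is compatible with this form only
when a = 0. -/
theorem rlIntegral_const_add_rpow_add {a α T M c₀ c : ℝ} {H : ℝ → ℝ} (ha0 : 0 ≤ a) (ha1 : a < 1)
    (hα : 1 ≤ α) (hc₀ : a ≠ 0 → c₀ = 0) (hH : Measurable H) (hM : ∀ s, |H s| ≤ M)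
    {t : ℝ} (ht : t ∈ Icc 0 T) :
    rlIntegral a (fun s => c₀ + c * s ^ (1 - a) + rlIntegral α H s) t =
      c₀ + c * Real.Gamma (2 - a) * t + rlIntegral (a + α) H t := by
  have hp : ContinuousOn (fun s : ℝ => c * s ^ (1 - a)) (Icc 0 T) :=
    (continuous_const.mul (Real.continuous_rpow_const (by linarith))).continuousOn
  have hc : ContinuousOn (fun _ : ℝ => c₀) (Icc 0 T) := continuousOn_const
  rw [rlIntegral_add_of_continuousOn ha0 ht (y := fun s => c₀ + c * s ^ (1 - a)) (hc.add hp)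
    (continuousOn_rlIntegral_of_one_le hα (ht.1.trans ht.2) hH hM),
    rlIntegral_add_of_continuousOn ha0 ht hc hp, rlIntegral_const_mul,
    rlIntegral_rpow ha0 (by linarith) ht.1, rlIntegral_const ha0 ht.1,
    rlIntegral_rlIntegral ha0 (by linarith) ht.1 hH fun s _ => hM s,
    show 1 - a + 1 = 2 - a by ring, show a + (1 - a) + 1 = 1 + 1 by ring,
    show a + (1 - a) = 1 by ring, Real.Gamma_add_one one_ne_zero, Real.Gamma_one, Real.rpow_one]
  have : c₀ * (t ^ a / Real.Gamma (a + 1)) = c₀ := by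
    by_cases h : a = 0
    · simp [h]
    · simp [hc₀ h]
  rw [this]
  ring

theorem hilferGamma_sub_one (α β : ℝ) : hilferGamma α β - 1 = 1 - (1 - β) * (2 - α) := by
  unfold hilferGamma; ring

theorem rlIntegral_two_eq {T M t : ℝ} {H : ℝ → ℝ} (ht : t ∈ Icc 0 T)
    (hH : Measurable H) (hM : ∀ s, |H s| ≤ M) :
    rlIntegral 1 (rlIntegral 1 H) t = rlIntegral 2 H t := by
  rw [rlIntegral_rlIntegral zero_le_one one_pos ht.1 hH fun s _ => hM s, one_add_one_eq_two]

/-- The fundamental theorem of calculus needs an integrable derivative on the open interval only, so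
neither continuity of h nor its end values matter. -/
theorem rlIntegral_one_eq_of_hasDerivWithinAt {T : ℝ} {v h H : ℝ → ℝ}
    (hH : IntervalIntegrable H volume 0 T) (hHh : EqOn H h (Ioo 0 T)) (hv0 : v 0 = 0)
    (hv : ∀ t ∈ Icc 0 T, HasDerivWithinAt v (h t) (Icc 0 T) t) :
    EqOn v (rlIntegral 1 H) (Icc 0 T) := by
  intro t ht
  rw [rlIntegral_one, intervalIntegral.integral_eq_sub_of_hasDerivAt_of_le (f := v) ht.1, hv0, sub_zero]
  · exact fun s hs => ((hv s ⟨hs.1, hs.2.trans ht.2⟩).continuousWithinAt).mono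
      (Icc_subset_Icc_right ht.2)
  · intro s hs
    have hs' : s ∈ Ioo 0 T := ⟨hs.1, hs.2.trans_le ht.2⟩
    rw [hHh hs']
    exact (hv s (Ioo_subset_Icc_self hs')).hasDerivAt (Icc_mem_nhds hs'.1 hs'.2)
  · exact hH.mono_set (by
      rw [uIcc_of_le ht.1, uIcc_of_le (ht.1.trans ht.2)]
      exact Icc_subset_Icc_right ht.2)

/-- Two integrations give I^b g = I² H = I^b I^(a+α) H. Cancelling I^b leaves I^a y = u(0) + u₁ t +
I^(a+α) H; the right side is I^a of the claimed form, and I^a is cancelled in turn. -/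
theorem HasHilferDeriv.exists_eq {α β T M : ℝ} {y h H : ℝ → ℝ} (hα1 : 1 < α) (hα2 : α < 2)
    (hβ0 : 0 ≤ β) (hβ1 : β ≤ 1) (hT : 0 < T) (hy : ContinuousOn y (Icc 0 T))
    (hyh : HasHilferDeriv α β T y h) (hH : Measurable H) (hM : ∀ s, |H s| ≤ M)
    (hHh : EqOn H h (Ioo 0 T)) :
    ∃ c₀ c : ℝ, ((1 - β) * (2 - α) ≠ 0 → c₀ = 0) ∧
      ∀ t ∈ Icc 0 T, y t = c₀ + c * t ^ (hilferGamma α β - 1) + rlIntegral α H t := by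
  obtain ⟨u₁, v, hu, hv⟩ := hyh
  rw [hilferGamma_sub_one]
  set a := (1 - β) * (2 - α) with ha
  set b := β * (2 - α) with hb
  have hab : a + α = 2 - b := by rw [ha, hb]; ring
  have ha0 : 0 ≤ a := mul_nonneg (by linarith) (by linarith)
  have hb0 : 0 ≤ b := mul_nonneg hβ0 (by linarith)
  have ha1 : a < 1 := by linarith
  have hb1 : b < 1 := by linarith
  set u := rlIntegral a y with hu_def
  have huc : ContinuousOn u (Icc 0 T) := continuousOn_rlIntegral ha0 hT.le hy
  set g := fun s => u s - u 0 - u₁ * s with hg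
  have hgc : ContinuousOn g (Icc 0 T) := by fun_prop
  have hg0 : g 0 = 0 := by simp [hg]
  have hgd : HasDerivWithinAt g 0 (Icc 0 T) 0 := by
    have := (hu.sub_const (u 0)).sub ((hasDerivWithinAt_id 0 (Icc 0 T)).const_mul u₁)
    simpa [hg, Function.comp_def, Pi.sub_def] using this
  have h0T : (0 : ℝ) ∈ Icc 0 T := ⟨le_rfl, hT.le⟩
  have hv0 : v 0 = 0 := (uniqueDiffOn_Icc hT 0 h0T).eq_deriv _ (hv 0 h0T).1
    (rlIntegral_hasDerivWithinAt_zero hb0 hT hg0 hgd)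
  have hw0 : rlIntegral b g 0 = 0 := by
    rcases hb0.eq_or_lt with hb' | hb'
    · rw [← hb', rlIntegral_zero_left, hg0]
    · exact rlIntegral_apply_zero hb'.ne' g
  have hv1 := rlIntegral_one_eq_of_hasDerivWithinAt (intervalIntegrable_of_abs_le hH hM 0 T)
    hHh hv0 fun t ht => (hv t ht).2
  have hIc := continuous_rlIntegral_one hH hM
  have hw : EqOn (rlIntegral b g) (rlIntegral 2 H) (Icc 0 T) := fun t ht => by
    rw [← rlIntegral_two_eq ht hH hM]
    refine rlIntegral_one_eq_of_hasDerivWithinAt (h := v) (hIc.intervalIntegrable 0 T)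
      (fun s hs => (hv1 (Ioo_subset_Icc_self hs)).symm) hw0 (fun s hs => (hv s hs).1) ht
  have hgI : EqOn g (rlIntegral (a + α) H) (Icc 0 T) := by
    refine eqOn_of_rlIntegral_eqOn hb0 hb1.le hT hgc
      (continuousOn_rlIntegral_of_one_le (by linarith) hT.le hH hM) fun t ht => ?_
    rw [hw ht, rlIntegral_rlIntegral hb0 (by linarith) ht.1 hH fun s _ => hM s, hab]
    ring_nf
  have hc₀ : a ≠ 0 → u 0 = 0 := fun h => rlIntegral_apply_zero h y
  -- The divisor compensates I^a t^(1-a) = Γ(2 - a) t.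
  refine ⟨u 0, u₁ / Real.Gamma (2 - a), hc₀, ?_⟩
  refine eqOn_of_rlIntegral_eqOn ha0 ha1.le hT hy ?_ fun t ht => ?_
  · have := continuousOn_rlIntegral_of_one_le hα1.le hT.le hH hM
    exact (continuous_const.add (continuous_const.mul
      (Real.continuous_rpow_const (by linarith)))).continuousOn.add this
  · rw [rlIntegral_const_add_rpow_add ha0 ha1 hα1.le hc₀ hH hM ht, ← hgI ht,
      div_mul_cancel₀ _ (Real.Gamma_pos_of_pos (by linarith)).ne']
    simp [hg, hu_def]

/-- Continuity of H makes I^1 H differentiable with derivative H at every point, end points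
included. -/
theorem hasHilferDeriv_of_eq {α β T M c₀ c : ℝ} {x H : ℝ → ℝ} (hα1 : 1 < α) (hα2 : α < 2)
    (hβ0 : 0 ≤ β) (hβ1 : β ≤ 1) (hT : 0 < T) (hc₀ : (1 - β) * (2 - α) ≠ 0 → c₀ = 0)
    (hH : Continuous H) (hM : ∀ s, |H s| ≤ M)
    (hx : ∀ t ∈ Icc 0 T, x t = c₀ + c * t ^ (hilferGamma α β - 1) + rlIntegral α H t) :
    HasHilferDeriv α β T x H := by
  rw [hilferGamma_sub_one] at hx
  unfold HasHilferDeriv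
  set a := (1 - β) * (2 - α) with ha
  set b := β * (2 - α) with hb
  have hab : a + α = 2 - b := by rw [ha, hb]; ring
  have ha0 : 0 ≤ a := mul_nonneg (by linarith) (by linarith)
  have hb0 : 0 ≤ b := mul_nonneg hβ0 (by linarith)
  have ha1 : a < 1 := by linarith
  have hb1 : b < 1 := by linarith
  have hHm := hH.measurable
  have hu : EqOn (rlIntegral a x)
      (fun t => c₀ + c * Real.Gamma (2 - a) * t + rlIntegral (a + α) H t) (Icc 0 T) := fun t ht => by
    refine Eq.trans ?_ (rlIntegral_const_add_rpow_add ha0 ha1 hα1.le hc₀ hHm hM ht)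
    exact rlIntegral_congr ht.1 fun s hs => hx s ⟨hs.1, hs.2.trans ht.2⟩
  have h0T : (0 : ℝ) ∈ Icc 0 T := ⟨le_rfl, hT.le⟩
  have hu0 : rlIntegral a x 0 = c₀ := by
    rw [hu h0T]
    simp [rlIntegral_apply_zero (show a + α ≠ 0 by linarith)]
  refine ⟨c * Real.Gamma (2 - a), rlIntegral 1 H, ?_, fun t ht => ⟨?_, ?_⟩⟩
  · refine HasDerivWithinAt.congr_of_mem ?_ hu h0T
    -- I^(a+α) H is O(t^(a+α)) with a + α > 1, so it does not contribute to u'(0).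
    have h1 : HasDerivWithinAt (rlIntegral (a + α) H) 0 (Icc 0 T) 0 := by
      refine hasDerivWithinAt_zero_of_le_rpow (p := a + α)
        (C := M / Real.Gamma (a + α + 1)) (by linarith) (fun t ht => ?_) hT.le
      refine (abs_rlIntegral_le (by linarith) ht.1 fun s _ => hM s).trans_eq (by ring)
    simpa [Pi.add_def] using (((hasDerivWithinAt_id 0 (Icc 0 T)).const_mul
      (c * Real.Gamma (2 - a))).const_add c₀).add h1
  · refine (hasDerivWithinAt_rlIntegral_one
      (continuous_rlIntegral_one hHm hM).continuousOn ht).congr_of_mem (fun s hs => ?_) ht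
    have h2 := rlIntegral_rlIntegral (b := a + α) hb0 (by linarith) hs.1 hHm fun s _ => hM s
    rw [show b + (a + α) = 2 by linarith] at h2
    rw [rlIntegral_two_eq hs hHm hM, hu0, ← h2]
    refine rlIntegral_congr hs.1 fun r hr => ?_
    rw [hu ⟨hr.1, hr.2.trans hs.2⟩]
    ring
  · exact hasDerivWithinAt_rlIntegral_one hH.continuousOn ht

/-! ### The Erdélyi–Kober integral -/

/-- The substitution w = s^η turns this into a beta integral. It is made on `(0, ∞)`, with the
integrands cut off at t^η and t. -/
theorem integral_ekIntegrand_rpow {η μ δ p t : ℝ} (hη : 0 < η) (hδ : 0 < δ) (ht : 0 < t)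
    (hp : 0 < μ + p / η + 1) :
    ∫ s in (0 : ℝ)..t, ekIntegrand η μ δ (fun s => s ^ p) t s =
      1 / η * (t ^ (η * (δ + μ)) * t ^ p *
        (Real.Gamma (μ + p / η + 1) * Real.Gamma δ / Real.Gamma (μ + p / η + δ + 1))) := by
  set g : ℝ → ℝ := (Ioo 0 (t ^ η)).indicator
    fun w => w ^ (μ + p / η + 1 - 1) * (t ^ η - w) ^ (δ - 1) with hg
  have htη : 0 < t ^ η := Real.rpow_pos_of_pos ht η
  have h := integral_comp_rpow_Ioi_of_pos (g := g) hη
  have h1 : ∫ w in Ioi 0, g w = (t ^ η) ^ (μ + p / η + 1 + δ - 1) *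
      (Real.Gamma (μ + p / η + 1) * Real.Gamma δ / Real.Gamma (μ + p / η + 1 + δ)) := by
    rw [← integral_rpow_mul_sub_rpow hp hδ htη, intervalIntegral.integral_of_le htη.le,
      integral_Ioc_eq_integral_Ioo, hg, setIntegral_indicator measurableSet_Ioo,
      inter_eq_self_of_subset_right fun s hs => hs.1]
  have h2 : ∫ s in Ioi (0 : ℝ), (η * s ^ (η - 1)) • g (s ^ η) =
      η * ∫ s in (0 : ℝ)..t, ekIntegrand η μ δ (fun s => s ^ p) t s := by
    rw [intervalIntegral.integral_of_le ht.le, integral_Ioc_eq_integral_Ioo, ← integral_const_mul,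
      ← inter_eq_self_of_subset_right (show Ioo 0 t ⊆ Ioi 0 from fun s hs => hs.1),
      ← setIntegral_indicator measurableSet_Ioo]
    refine setIntegral_congr_fun measurableSet_Ioi fun s hs => ?_
    have hs0 : 0 < s := hs
    have hsη : 0 < s ^ η := Real.rpow_pos_of_pos hs0 η
    by_cases hst : s < t
    · have hlt : s ^ η < t ^ η := Real.rpow_lt_rpow hs0.le hst hη
      simp only [hg, smul_eq_mul]
      rw [indicator_of_mem (show s ^ η ∈ Ioo 0 (t ^ η) from ⟨hsη, hlt⟩),
        indicator_of_mem (show s ∈ Ioo 0 t from ⟨hs0, hst⟩), ekIntegrand,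
        ← Real.rpow_mul hs0.le, ← Real.rpow_add hs0, ← neg_sub 1 δ,
        Real.rpow_neg (sub_nonneg.2 hlt.le), mul_assoc, ← mul_assoc (s ^ (η - 1)),
        ← Real.rpow_add hs0, ← div_eq_mul_inv (s ^ _)]
      congr 3
      field_simp
      ring
    · simp only [hg, smul_eq_mul]
      rw [indicator_of_notMem, indicator_of_notMem, mul_zero]
      · exact fun h => hst h.2
      · exact fun h => hst ((Real.rpow_lt_rpow_iff hs0.le ht.le hη).1 h.2)
  rw [h2, h1] at h
  rw [show μ + p / η + δ + 1 = μ + p / η + 1 + δ by ring, ← Real.rpow_add ht,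
    show η * (δ + μ) + p = η * (μ + p / η + 1 + δ - 1) by field_simp; ring, Real.rpow_mul ht.le, ← h]
  field_simp

theorem intervalIntegrable_ekIntegrand_rpow {η μ δ p t : ℝ} (hη : 0 < η) (hδ : 0 < δ) (ht : 0 < t)
    (hp : 0 < μ + p / η + 1) :
    IntervalIntegrable (ekIntegrand η μ δ (fun s => s ^ p) t) volume 0 t := by
  by_contra h
  have h1 := intervalIntegral.integral_undef h
  rw [integral_ekIntegrand_rpow hη hδ ht hp] at h1
  have := Real.Gamma_pos_of_pos hp
  have := Real.Gamma_pos_of_pos hδ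
  have := Real.Gamma_pos_of_pos (show 0 < μ + p / η + δ + 1 by linarith)
  refine absurd h1 (ne_of_gt ?_)
  positivity

/-- Powers are eigenfunctions up to the factor that appears in Δ (for p = γ - 1) and in Ω (for p =
α). -/
theorem ekIntegral_rpow {η μ δ p t : ℝ} (hη : 0 < η) (hδ : 0 < δ) (ht : 0 < t)
    (hp : 0 < μ + p / η + 1) :
    ekIntegral η μ δ (fun s => s ^ p) t =
      t ^ p * (Real.Gamma (μ + p / η + 1) / Real.Gamma (μ + p / η + δ + 1)) := by
  rw [ekIntegral, integral_ekIntegrand_rpow hη hδ ht hp, Real.rpow_neg ht.le]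
  have := (Real.Gamma_pos_of_pos hδ).ne'
  have := (Real.rpow_pos_of_pos ht (η * (δ + μ))).ne'
  field_simp

theorem ekIntegrand_nonneg {η μ δ t s : ℝ} {y : ℝ → ℝ} (hη : 0 < η) (hs : s ∈ Icc 0 t)
    (hy : 0 ≤ y s) : 0 ≤ ekIntegrand η μ δ y t s :=
  div_nonneg (mul_nonneg (Real.rpow_nonneg hs.1 _) hy)
    (Real.rpow_nonneg (sub_nonneg.2 (Real.rpow_le_rpow hs.1 hs.2 hη.le)) _)

theorem ekIntegrand_congr {η μ δ t s : ℝ} {y z : ℝ → ℝ} (h : y s = z s) :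
    ekIntegrand η μ δ y t s = ekIntegrand η μ δ z t s := by
  simp only [ekIntegrand, h]

theorem ekIntegrand_const_mul (η μ δ c t s : ℝ) (y : ℝ → ℝ) :
    ekIntegrand η μ δ (fun s => c * y s) t s = c * ekIntegrand η μ δ y t s := by
  simp only [ekIntegrand]; ring

theorem ekIntegrand_add (η μ δ t s : ℝ) (y z : ℝ → ℝ) :
    ekIntegrand η μ δ (fun s => y s + z s) t s =
      ekIntegrand η μ δ y t s + ekIntegrand η μ δ z t s := by
  simp only [ekIntegrand]; ring

theorem abs_ekIntegrand_le {η μ δ p C t s : ℝ} {y : ℝ → ℝ} (hη : 0 < η) (hs : s ∈ Icc 0 t)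
    (hy : |y s| ≤ C * s ^ p) :
    |ekIntegrand η μ δ y t s| ≤ C * ekIntegrand η μ δ (fun s => s ^ p) t s := by
  have h : |ekIntegrand η μ δ y t s| = ekIntegrand η μ δ (fun s => |y s|) t s := by
    have h1 := Real.rpow_nonneg hs.1 (η * μ + η - 1)
    have h2 := Real.rpow_nonneg (sub_nonneg.2 (Real.rpow_le_rpow hs.1 hs.2 hη.le)) (1 - δ)
    rw [ekIntegrand, abs_div, abs_mul, abs_of_nonneg h1, abs_of_nonneg h2, ekIntegrand]
  rw [h, ← ekIntegrand_const_mul, ← sub_nonneg]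
  have := ekIntegrand_nonneg (μ := μ) (δ := δ) (y := fun s => C * s ^ p - |y s|) hη hs
    (sub_nonneg.2 hy)
  simp only [ekIntegrand] at this ⊢
  linear_combination this

theorem intervalIntegrable_ekIntegrand {η μ δ p C t : ℝ} {y : ℝ → ℝ} (hη : 0 < η) (hδ : 0 < δ)
    (ht : 0 < t) (hp : 0 < μ + p / η + 1) (hym : ContinuousOn y (Icc 0 t))
    (hy : ∀ s ∈ Icc 0 t, |y s| ≤ C * s ^ p) :
    IntervalIntegrable (ekIntegrand η μ δ y t) volume 0 t := by
  refine ((intervalIntegrable_ekIntegrand_rpow hη hδ ht hp).const_mul C).mono_fun' ?_ ?_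
  · rw [uIoc_of_le ht.le]
    have hyI := (hym.mono Ioc_subset_Icc_self).aestronglyMeasurable (μ := volume) measurableSet_Ioc
    unfold ekIntegrand
    refine AEMeasurable.aestronglyMeasurable ?_
    exact (((by fun_prop : Measurable fun s : ℝ => s ^ (η * μ + η - 1)).aemeasurable).mul
      hyI.aemeasurable).div (by fun_prop : Measurable fun s : ℝ => (t ^ η - s ^ η) ^ (1 - δ)).aemeasurable
  · refine (ae_restrict_iff' measurableSet_uIoc).2 (.of_forall fun s hs => ?_)
    rw [uIoc_of_le ht.le] at hs
    exact abs_ekIntegrand_le hη (Ioc_subset_Icc_self hs) (hy s (Ioc_subset_Icc_self hs))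

theorem abs_ekIntegral_le {η μ δ p C t : ℝ} {y : ℝ → ℝ} (hη : 0 < η) (hδ : 0 < δ)
    (ht : 0 < t) (hp : 0 < μ + p / η + 1) (hy : ∀ s ∈ Icc 0 t, |y s| ≤ C * s ^ p) :
    |ekIntegral η μ δ y t| ≤
      C * (t ^ p * (Real.Gamma (μ + p / η + 1) / Real.Gamma (μ + p / η + δ + 1))) := by
  rw [← ekIntegral_rpow hη hδ ht hp, ekIntegral, ekIntegral, abs_mul, mul_left_comm]
  have hG := Real.Gamma_pos_of_pos hδ
  rw [abs_of_pos (show 0 < η * t ^ (-(η * (δ + μ))) / Real.Gamma δ by positivity)]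
  gcongr
  rw [← intervalIntegral.integral_const_mul, ← Real.norm_eq_abs]
  refine intervalIntegral.norm_integral_le_of_norm_le ht.le (.of_forall fun s hs => ?_)
    ((intervalIntegrable_ekIntegrand_rpow hη hδ ht hp).const_mul C)
  exact abs_ekIntegrand_le hη (Ioc_subset_Icc_self hs) (hy s (Ioc_subset_Icc_self hs))

theorem ekIntegral_congr {η μ δ t : ℝ} {y z : ℝ → ℝ} (ht : 0 ≤ t) (h : EqOn y z (Icc 0 t)) :
    ekIntegral η μ δ y t = ekIntegral η μ δ z t := by
  unfold ekIntegral
  congr 1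
  refine intervalIntegral.integral_congr fun s hs => ?_
  rw [uIcc_of_le ht] at hs
  exact ekIntegrand_congr (h hs)

theorem ekIntegral_const_mul (η μ δ c t : ℝ) (y : ℝ → ℝ) :
    ekIntegral η μ δ (fun s => c * y s) t = c * ekIntegral η μ δ y t := by
  simp only [ekIntegral, ekIntegrand_const_mul, intervalIntegral.integral_const_mul]
  ring

theorem ekIntegral_add {η μ δ t : ℝ} {y z : ℝ → ℝ}
    (hy : IntervalIntegrable (ekIntegrand η μ δ y t) volume 0 t)
    (hz : IntervalIntegrable (ekIntegrand η μ δ z t) volume 0 t) :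
    ekIntegral η μ δ (fun s => y s + z s) t = ekIntegral η μ δ y t + ekIntegral η μ δ z t := by
  simp only [ekIntegral, ekIntegrand_add]
  rw [intervalIntegral.integral_add hy hz, mul_add]

/-! ### The solution operator of the linear boundary value problem -/

/-- The standing assumptions on the parameters of the boundary value problem. -/
structure IsAdmissible (α β T : ℝ) {m : ℕ} (σ η μ δ ξ : Fin m → ℝ) : Prop where
  one_lt : 1 < α
  lt_two : α < 2
  zero_le : 0 ≤ β
  le_one : β ≤ 1
  pos : 0 < T
  eta_pos : ∀ i, 0 < η i
  delta_pos : ∀ i, 0 < δ i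
  xi_mem : ∀ i, ξ i ∈ Ioo 0 T
  mu_pos : ∀ i, 0 < μ i + (hilferGamma α β - 1) / η i + 1
  ne_zero : bvpDelta α β T σ η μ δ ξ ≠ 0

/-- The coefficient of `t ^ (γ - 1)` in the solution of the linear problem with right-hand
side `H`. -/
def bvpCoeff (α β T : ℝ) {m : ℕ} (σ η μ δ ξ : Fin m → ℝ) (H : ℝ → ℝ) : ℝ :=
  (∑ i, σ i * ekIntegral (η i) (μ i) (δ i) (rlIntegral α H) (ξ i) - rlIntegral α H T) /
    bvpDelta α β T σ η μ δ ξ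

/-- The solution of the linear problem with right-hand side `H`. -/
def bvpOp (α β T : ℝ) {m : ℕ} (σ η μ δ ξ : Fin m → ℝ) (H : ℝ → ℝ) (t : ℝ) : ℝ :=
  bvpCoeff α β T σ η μ δ ξ H * t ^ (hilferGamma α β - 1) + rlIntegral α H t

/-- Derivatives of approximate solutions are later controlled only on the open interval; replacing y
by 0 elsewhere leaves the integral unchanged. -/
theorem abs_rlIntegral_le_of_Ioo {a t M : ℝ} {y : ℝ → ℝ} (ha : 0 < a) (ht : 0 ≤ t) (hM0 : 0 ≤ M)
    (hM : ∀ s ∈ Ioo 0 t, |y s| ≤ M) :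
    |rlIntegral a y t| ≤ M / Real.Gamma (a + 1) * t ^ a := by
  rw [rlIntegral_congr_Ioo ha.ne' ht (z := (Ioo 0 t).indicator y)
    fun s hs => (indicator_of_mem hs y).symm]
  refine (abs_rlIntegral_le (M := M) ha.le ht fun s _ => ?_).trans_eq (by ring)
  by_cases h : s ∈ Ioo 0 t
  · rw [indicator_of_mem h]; exact hM s h
  · rwa [indicator_of_notMem h, abs_zero]

namespace IsAdmissible

variable {α β T : ℝ} {m : ℕ} {σ η μ δ ξ : Fin m → ℝ}

theorem gamma_sub_one_pos (h : IsAdmissible α β T σ η μ δ ξ) : 0 < hilferGamma α β - 1 := by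
  rw [hilferGamma_sub_one]
  nlinarith [h.one_lt, h.lt_two, h.zero_le, h.le_one]

/-- Convergence for the exponent γ - 1 carries over to α because γ - 1 ≤ α. -/
theorem mu_alpha_pos (h : IsAdmissible α β T σ η μ δ ξ) (i : Fin m) : 0 < μ i + α / η i + 1 := by
  have h1 := h.mu_pos i
  have h2 : hilferGamma α β - 1 ≤ α := by
    rw [hilferGamma_sub_one]
    nlinarith [h.one_lt, h.lt_two, h.zero_le, h.le_one]
  have := div_le_div_of_nonneg_right h2 (h.eta_pos i).le
  linarith

theorem omega_pos (h : IsAdmissible α β T σ η μ δ ξ) : 0 < bvpOmega α β T σ η μ δ ξ := by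
  have h1 := Real.Gamma_pos_of_pos (show 0 < α + 1 by linarith [h.one_lt])
  have h2 := Real.rpow_pos_of_pos h.pos
  have h3 := abs_pos.2 h.ne_zero
  unfold bvpOmega
  refine mul_pos (by positivity) (add_pos_of_pos_of_nonneg
    (add_pos (h2 _) (div_pos (h2 _) h3))
    (mul_nonneg (div_pos (h2 _) h3).le (Finset.sum_nonneg fun i _ => ?_)))
  have h4 := Real.Gamma_pos_of_pos (h.mu_alpha_pos i)
  have h5 := Real.Gamma_pos_of_pos (add_pos (h.delta_pos i) (h.mu_alpha_pos i))
  have h6 := (h.xi_mem i).1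
  rw [show α / η i + μ i + 1 = μ i + α / η i + 1 by ring,
    show δ i + α / η i + μ i + 1 = δ i + (μ i + α / η i + 1) by ring]
  positivity

/-- All terms come from |I^α H(s)| ≤ M s^α / Γ(α + 1): the first term of Ω bounds I^α H(t), the
other two bound the parts of the coefficient due to x(T) and to the Erdélyi–Kober sum. -/
theorem abs_bvpOp_le (h : IsAdmissible α β T σ η μ δ ξ) {H : ℝ → ℝ} {M : ℝ} (hM0 : 0 ≤ M)
    (hM : ∀ s ∈ Ioo 0 T, |H s| ≤ M) {t : ℝ} (ht : t ∈ Icc 0 T) :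
    |bvpOp α β T σ η μ δ ξ H t| ≤ bvpOmega α β T σ η μ δ ξ * M := by
  have hα0 : 0 < α := by linarith [h.one_lt]
  have hΓ := Real.Gamma_pos_of_pos (show 0 < α + 1 by linarith)
  have hΔ := abs_pos.2 h.ne_zero
  set C := M / Real.Gamma (α + 1) with hC
  have hC0 : 0 ≤ C := by positivity
  have hI : ∀ s ∈ Icc 0 T, |rlIntegral α H s| ≤ C * s ^ α := fun s hs =>
    abs_rlIntegral_le_of_Ioo hα0 hs.1 hM0 fun r hr => hM r ⟨hr.1, hr.2.trans_le hs.2⟩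
  set S := ∑ i, |σ i| * ξ i ^ α * Real.Gamma (α / η i + μ i + 1) /
          Real.Gamma (δ i + α / η i + μ i + 1) with hS
  have hsum : |∑ i, σ i * ekIntegral (η i) (μ i) (δ i) (rlIntegral α H) (ξ i)| ≤ C * S := by
    refine (Finset.abs_sum_le_sum_abs _ _).trans ?_
    rw [hS, Finset.mul_sum]
    refine Finset.sum_le_sum fun i _ => ?_
    have h1 := abs_ekIntegral_le (h.eta_pos i) (h.delta_pos i) (h.xi_mem i).1 (h.mu_alpha_pos i)
      (fun s hs => hI s ⟨hs.1, hs.2.trans (h.xi_mem i).2.le⟩)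
    rw [abs_mul]
    refine (mul_le_mul_of_nonneg_left h1 (abs_nonneg _)).trans_eq ?_
    rw [show α / η i + μ i + 1 = μ i + α / η i + 1 by ring,
      show δ i + α / η i + μ i + 1 = μ i + α / η i + δ i + 1 by ring]
    ring
  have hcoeff : |bvpCoeff α β T σ η μ δ ξ H| ≤ (C * S + C * T ^ α) / |bvpDelta α β T σ η μ δ ξ| := by
    rw [bvpCoeff, abs_div]
    gcongr
    exact (abs_sub _ _).trans (add_le_add hsum (hI T ⟨h.pos.le, le_rfl⟩))
  have hp := Real.rpow_le_rpow ht.1 ht.2 h.gamma_sub_one_pos.le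
  have hp0 := Real.rpow_nonneg ht.1 (hilferGamma α β - 1)
  have hα := Real.rpow_le_rpow ht.1 ht.2 hα0.le
  calc |bvpOp α β T σ η μ δ ξ H t|
      ≤ |bvpCoeff α β T σ η μ δ ξ H| * t ^ (hilferGamma α β - 1) + |rlIntegral α H t| := by
        rw [bvpOp]
        refine (abs_add_le _ _).trans_eq ?_
        rw [abs_mul, abs_of_nonneg hp0]
    _ ≤ (C * S + C * T ^ α) / |bvpDelta α β T σ η μ δ ξ| * T ^ (hilferGamma α β - 1) +
        C * T ^ α := by
        refine add_le_add (mul_le_mul hcoeff hp hp0 ((abs_nonneg _).trans hcoeff)) ((hI t ht).trans ?_)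
        gcongr
    _ = bvpOmega α β T σ η μ δ ξ * M := by
        rw [bvpOmega, ← hS, hC, show hilferGamma α β + α - 1 = α + (hilferGamma α β - 1) by ring,
          Real.rpow_add h.pos]
        field_simp
        ring

theorem intervalIntegrable_ekIntegrand_rlIntegral (h : IsAdmissible α β T σ η μ δ ξ) {H : ℝ → ℝ}
    {M : ℝ} (hH : Measurable H) (hM : ∀ s, |H s| ≤ M) (i : Fin m) :
    IntervalIntegrable (ekIntegrand (η i) (μ i) (δ i) (rlIntegral α H) (ξ i)) volume 0 (ξ i) :=
  intervalIntegrable_ekIntegrand (h.eta_pos i) (h.delta_pos i) (h.xi_mem i).1 (h.mu_alpha_pos i)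
    (continuousOn_rlIntegral_of_one_le h.one_lt.le (h.xi_mem i).1.le hH hM)
    fun s hs => abs_rlIntegral_le_of_Ioo (by linarith [h.one_lt]) hs.1
      ((abs_nonneg _).trans (hM 0)) fun r _ => hM r

theorem bvpOp_sub (h : IsAdmissible α β T σ η μ δ ξ) {H K : ℝ → ℝ} {M N : ℝ}
    (hH : Measurable H) (hM : ∀ s, |H s| ≤ M) (hK : Measurable K) (hN : ∀ s, |K s| ≤ N)
    {t : ℝ} (ht : t ∈ Icc 0 T) :
    bvpOp α β T σ η μ δ ξ (fun s => H s - K s) t =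
      bvpOp α β T σ η μ δ ξ H t - bvpOp α β T σ η μ δ ξ K t := by
  have hα0 : 0 ≤ α := by linarith [h.one_lt]
  have hI : ∀ s, 0 ≤ s →
      rlIntegral α (fun s => H s - K s) s = rlIntegral α H s + (-1) * rlIntegral α K s :=
    fun s hs => by rw [rlIntegral_sub hα0 hs hH (fun s _ => hM s) hK (fun s _ => hN s)]; ring
  have hE : ∀ i, ekIntegral (η i) (μ i) (δ i) (rlIntegral α fun s => H s - K s) (ξ i) =
      ekIntegral (η i) (μ i) (δ i) (rlIntegral α H) (ξ i) -
        ekIntegral (η i) (μ i) (δ i) (rlIntegral α K) (ξ i) := fun i => by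
    rw [ekIntegral_congr (h.xi_mem i).1.le fun s hs => hI s hs.1,
      ekIntegral_add (h.intervalIntegrable_ekIntegrand_rlIntegral hH hM i), ekIntegral_const_mul]
    · ring
    · simp only [funext fun s => ekIntegrand_const_mul (η i) (μ i) (δ i) (-1) (ξ i) s (rlIntegral α K)]
      exact (h.intervalIntegrable_ekIntegrand_rlIntegral hK hN i).const_mul _
  simp only [bvpOp, bvpCoeff, hE, hI t ht.1, hI T h.pos.le, mul_sub, Finset.sum_sub_distrib]
  ring

theorem continuousOn_bvpOp (h : IsAdmissible α β T σ η μ δ ξ) {H : ℝ → ℝ} {M : ℝ}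
    (hH : Measurable H) (hM : ∀ s, |H s| ≤ M) :
    ContinuousOn (bvpOp α β T σ η μ δ ξ H) (Icc 0 T) :=
  (continuous_const.mul (Real.continuous_rpow_const h.gamma_sub_one_pos.le)).continuousOn.add
    (continuousOn_rlIntegral_of_one_le h.one_lt.le h.pos.le hH hM)

/-- The value at 0 and the convergence are automatic from γ - 1 > 0 and `mu_pos`. The remaining
condition reads cΔ = ∑ σᵢ I_{ηᵢ}^{μᵢ,δᵢ}(I^α H)(ξᵢ) - I^α H(T). -/
theorem boundaryConditions_iff (h : IsAdmissible α β T σ η μ δ ξ) {x H : ℝ → ℝ} {M c : ℝ}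
    (hH : Measurable H) (hM : ∀ s, |H s| ≤ M)
    (hx : ∀ t ∈ Icc 0 T, x t = c * t ^ (hilferGamma α β - 1) + rlIntegral α H t) :
    BoundaryConditions T σ η μ δ ξ x ↔ c = bvpCoeff α β T σ η μ δ ξ H := by
  have hx' : ∀ i, EqOn x (fun t => c * t ^ (hilferGamma α β - 1) + rlIntegral α H t)
      (Icc 0 (ξ i)) := fun i t ht => hx t ⟨ht.1, ht.2.trans (h.xi_mem i).2.le⟩
  have h0 : x 0 = 0 := by
    rw [hx 0 ⟨le_rfl, h.pos.le⟩, Real.zero_rpow h.gamma_sub_one_pos.ne',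
      rlIntegral_apply_zero (by linarith [h.one_lt]), mul_zero, add_zero]
  have hpow : ∀ i, IntervalIntegrable (ekIntegrand (η i) (μ i) (δ i)
      (fun t => c * t ^ (hilferGamma α β - 1)) (ξ i)) volume 0 (ξ i) := fun i => by
    simp only [funext fun s => ekIntegrand_const_mul (η i) (μ i) (δ i) c (ξ i) s
      (fun t => t ^ (hilferGamma α β - 1))]
    exact (intervalIntegrable_ekIntegrand_rpow (h.eta_pos i) (h.delta_pos i) (h.xi_mem i).1
      (h.mu_pos i)).const_mul c
  have hrl := h.intervalIntegrable_ekIntegrand_rlIntegral hH hM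
  have hint : ∀ i, IntervalIntegrable (ekIntegrand (η i) (μ i) (δ i) x (ξ i)) volume 0 (ξ i) :=
    fun i => by
      refine ((hpow i).add (hrl i)).congr fun s hs => ?_
      rw [uIoc_of_le (h.xi_mem i).1.le] at hs
      exact (ekIntegrand_add _ _ _ _ _ _ _).symm.trans
        (ekIntegrand_congr (hx' i (Ioc_subset_Icc_self hs)).symm)
  have hek : ∀ i, ekIntegral (η i) (μ i) (δ i) x (ξ i) =
      c * (ξ i ^ (hilferGamma α β - 1) * (Real.Gamma (μ i + (hilferGamma α β - 1) / η i + 1) /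
        Real.Gamma (μ i + (hilferGamma α β - 1) / η i + δ i + 1))) +
      ekIntegral (η i) (μ i) (δ i) (rlIntegral α H) (ξ i) := fun i => by
    rw [ekIntegral_congr (h.xi_mem i).1.le (hx' i), ekIntegral_add (hpow i) (hrl i),
      ekIntegral_const_mul, ekIntegral_rpow (h.eta_pos i) (h.delta_pos i) (h.xi_mem i).1 (h.mu_pos i)]
  have hsum : ∑ i, σ i * ekIntegral (η i) (μ i) (δ i) x (ξ i) =
      c * (T ^ (hilferGamma α β - 1) - bvpDelta α β T σ η μ δ ξ) +
        ∑ i, σ i * ekIntegral (η i) (μ i) (δ i) (rlIntegral α H) (ξ i) := by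
    simp only [hek, bvpDelta, sub_sub_cancel, mul_add, Finset.sum_add_distrib, Finset.mul_sum]
    congr 1
    exact Finset.sum_congr rfl fun i _ => by ring
  rw [bvpCoeff, eq_div_iff h.ne_zero]
  constructor
  · rintro ⟨-, -, hT⟩
    rw [hsum, hx T ⟨h.pos.le, le_rfl⟩] at hT
    linarith
  · intro hc
    refine ⟨h0, hint, ?_⟩
    rw [hsum, hx T ⟨h.pos.le, le_rfl⟩]
    linarith

end IsAdmissible

/-! ### Approximate solutions -/

theorem HasHilferDeriv.congr {α β T : ℝ} {y h k : ℝ → ℝ} (hy : HasHilferDeriv α β T y h)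
    (hk : EqOn h k (Icc 0 T)) : HasHilferDeriv α β T y k := by
  obtain ⟨u₁, v, hu, hv⟩ := hy
  exact ⟨u₁, v, hu, fun t ht => ⟨(hv t ht).1, hk ht ▸ (hv t ht).2⟩⟩

/-- Inside the interval h is the derivative of v, hence measurable; H is set to 0 elsewhere. -/
theorem HasHilferDeriv.exists_measurable {α β T N : ℝ} {y h : ℝ → ℝ}
    (hy : HasHilferDeriv α β T y h) (hN0 : 0 ≤ N) (hN : ∀ t ∈ Icc 0 T, |h t| ≤ N) :
    ∃ H : ℝ → ℝ, Measurable H ∧ (∀ s, |H s| ≤ N) ∧ EqOn H h (Ioo 0 T) := by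
  obtain ⟨u₁, v, hu, hv⟩ := hy
  have hd : EqOn ((Ioo 0 T).indicator (deriv v)) h (Ioo 0 T) := fun t ht => by
    rw [indicator_of_mem ht]
    exact ((hv t (Ioo_subset_Icc_self ht)).2.hasDerivAt (Icc_mem_nhds ht.1 ht.2)).deriv
  refine ⟨_, (measurable_deriv v).indicator measurableSet_Ioo, fun s => ?_, hd⟩
  by_cases hs : s ∈ Ioo 0 T
  · rw [hd hs]; exact hN s (Ioo_subset_Icc_self hs)
  · rwa [indicator_of_notMem hs, abs_zero]

theorem ContinuousOn.comp_graph {T : ℝ} {f : ℝ → ℝ → ℝ} {x : ℝ → ℝ}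
    (hf : ContinuousOn (fun p : ℝ × ℝ => f p.1 p.2) (Icc 0 T ×ˢ univ))
    (hx : ContinuousOn x (Icc 0 T)) : ContinuousOn (fun t => f t (x t)) (Icc 0 T) :=
  hf.comp (continuousOn_id.prodMk hx) fun _ ht => ⟨ht, mem_univ _⟩

namespace IsAdmissible

variable {α β T : ℝ} {m : ℕ} {σ η μ δ ξ : Fin m → ℝ}

theorem exists_eq_of_solvesInequality (hd : IsAdmissible α β T σ η μ δ ξ) {f : ℝ → ℝ → ℝ}
    {ε : ℝ} {y : ℝ → ℝ} (hf : ContinuousOn (fun p : ℝ × ℝ => f p.1 p.2) (Icc 0 T ×ˢ univ))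
    (hy : SolvesInequality α β T f ε y) :
    ∃ (H : ℝ → ℝ) (M c₀ c : ℝ), Measurable H ∧ (∀ s, |H s| ≤ M) ∧
      (∀ t ∈ Ioo 0 T, |H t - f t (y t)| ≤ ε) ∧ ((1 - β) * (2 - α) ≠ 0 → c₀ = 0) ∧
      ∀ t ∈ Icc 0 T, y t = c₀ + c * t ^ (hilferGamma α β - 1) + rlIntegral α H t := by
  obtain ⟨hyc, h, hyh, hh⟩ := hy
  -- f(t, y(t)) is bounded by compactness, so h, which is within ε of it, is bounded too.
  obtain ⟨B, hB⟩ := isCompact_Icc.exists_bound_of_continuousOn (ContinuousOn.comp_graph hf hyc)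
  have hN : ∀ t ∈ Icc 0 T, |h t| ≤ ε + B := fun t ht => by
    calc |h t| = |(h t - f t (y t)) + f t (y t)| := by rw [sub_add_cancel]
      _ ≤ ε + B := (abs_add_le _ _).trans (add_le_add (hh t ht) (hB t ht))
  obtain ⟨H, hH, hM, hHh⟩ :=
    hyh.exists_measurable ((abs_nonneg _).trans (hN 0 ⟨le_rfl, hd.pos.le⟩)) hN
  obtain ⟨c₀, c, hc₀, hc⟩ := hyh.exists_eq hd.one_lt hd.lt_two hd.zero_le hd.le_one hd.pos hyc
    hH hM hHh
  exact ⟨H, _, c₀, c, hH, hM, fun t ht => hHh ht ▸ hh t (Ioo_subset_Icc_self ht), hc₀, hc⟩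

theorem exists_eq_bvpOp (hd : IsAdmissible α β T σ η μ δ ξ) {f : ℝ → ℝ → ℝ}
    {ε : ℝ} {y : ℝ → ℝ} (hf : ContinuousOn (fun p : ℝ × ℝ => f p.1 p.2) (Icc 0 T ×ˢ univ))
    (hy : SolvesPerturbedProblem α β T f σ η μ δ ξ ε y) :
    ∃ (H : ℝ → ℝ) (M : ℝ), Measurable H ∧ (∀ s, |H s| ≤ M) ∧
      (∀ t ∈ Ioo 0 T, |H t - f t (y t)| ≤ ε) ∧ EqOn y (bvpOp α β T σ η μ δ ξ H) (Icc 0 T) := by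
  obtain ⟨H, M, c₀, c, hH, hM, hHf, -, hc⟩ := hd.exists_eq_of_solvesInequality hf hy.1
  -- At t = 0 the power and the fractional integral vanish, leaving y(0) = c₀.
  have h0 : c₀ = 0 := by
    have h1 := hc 0 ⟨le_rfl, hd.pos.le⟩
    rwa [hy.2.1, Real.zero_rpow hd.gamma_sub_one_pos.ne', rlIntegral_apply_zero
      (by linarith [hd.one_lt]), mul_zero, add_zero, add_zero, eq_comm] at h1
  simp only [h0, zero_add] at hc
  have h2 := (hd.boundaryConditions_iff hH hM hc).1 hy.2
  exact ⟨H, M, hH, hM, hHf, fun t ht => by rw [hc t ht, bvpOp, h2]⟩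

/-- With D = max |x - y|, the Lipschitz bound gives D ≤ Ω(LD + ε), to be solved for D. Only x - y
need lie in the range of `bvpOp`, so boundary conditions on x and y separately play no role. -/
theorem abs_sub_le (hd : IsAdmissible α β T σ η μ δ ξ) {f : ℝ → ℝ → ℝ} {L ε : ℝ}
    {x y F H : ℝ → ℝ} (hL : 0 ≤ L)
    (hf : ∀ t ∈ Icc 0 T, ∀ x y : ℝ, |f t x - f t y| ≤ L * |x - y|)
    (hLΩ : L * bvpOmega α β T σ η μ δ ξ < 1) (hε : 0 ≤ ε)
    (hx : ContinuousOn x (Icc 0 T)) (hy : ContinuousOn y (Icc 0 T))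
    (hF : ∀ t ∈ Ioo 0 T, F t = f t (x t)) (hH : ∀ t ∈ Ioo 0 T, |H t - f t (y t)| ≤ ε)
    (hxy : ∀ t ∈ Icc 0 T, x t - y t = bvpOp α β T σ η μ δ ξ (fun s => F s - H s) t)
    {t : ℝ} (ht : t ∈ Icc 0 T) :
    |y t - x t| ≤ bvpOmega α β T σ η μ δ ξ / (1 - L * bvpOmega α β T σ η μ δ ξ) * ε := by
  have hΩ := hd.omega_pos
  obtain ⟨t₀, ht₀, hmax⟩ := isCompact_Icc.exists_isMaxOn (nonempty_Icc.2 hd.pos.le) (hx.sub hy).abs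
  set D := |x t₀ - y t₀| with hD
  have hDle : ∀ s ∈ Icc 0 T, |x s - y s| ≤ D := fun s hs => hmax hs
  have hFH : ∀ s ∈ Ioo 0 T, |F s - H s| ≤ L * D + ε := fun s hs => by
    have hs' := Ioo_subset_Icc_self hs
    calc |F s - H s| = |(f s (x s) - f s (y s)) + -(H s - f s (y s))| := by
          rw [hF s hs]; congr 1; ring
      _ ≤ L * D + ε := by
          refine (abs_add_le _ _).trans (add_le_add ((hf s hs' _ _).trans ?_) ?_)
          · exact mul_le_mul_of_nonneg_left (hDle s hs') hL
          · rw [abs_neg]; exact hH s hs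
  have h1 : D ≤ bvpOmega α β T σ η μ δ ξ * (L * D + ε) := by
    refine (hD.trans (congrArg _ (hxy t₀ ht₀))).trans_le ?_
    exact hd.abs_bvpOp_le (by positivity) hFH ht₀
  rw [abs_sub_comm]
  refine (hDle t ht).trans ?_
  rw [div_mul_eq_mul_div, le_div_iff₀ (by linarith)]
  linarith

/-- Banach's theorem in C([0, T]) with constant LΩ. The shift by y and H cancels in differences; y =
H = 0 gives the boundary value problem, while an approximate solution y with derivative H gives the
equation alone. -/
theorem exists_fixedPoint (hd : IsAdmissible α β T σ η μ δ ξ) {f : ℝ → ℝ → ℝ} {L M : ℝ}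
    {y H : ℝ → ℝ} (hL : 0 ≤ L)
    (hfc : ContinuousOn (fun p : ℝ × ℝ => f p.1 p.2) (Icc 0 T ×ˢ univ))
    (hf : ∀ t ∈ Icc 0 T, ∀ x y : ℝ, |f t x - f t y| ≤ L * |x - y|)
    (hLΩ : L * bvpOmega α β T σ η μ δ ξ < 1)
    (hy : ContinuousOn y (Icc 0 T)) (hH : Measurable H) (hM : ∀ s, |H s| ≤ M) :
    ∃ (x F : ℝ → ℝ) (N : ℝ), ContinuousOn x (Icc 0 T) ∧ Continuous F ∧ (∀ s, |F s| ≤ N) ∧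
      EqOn F (fun t => f t (x t)) (Icc 0 T) ∧
      ∀ t ∈ Icc 0 T, x t = y t + bvpOp α β T σ η μ δ ξ (fun s => F s - H s) t := by
  have hΩ := hd.omega_pos
  let ext (z : C(Icc (0 : ℝ) T, ℝ)) (s : ℝ) : ℝ := z (projIcc 0 T hd.pos.le s)
  have hext : ∀ z, Continuous (ext z) := fun z => z.continuous.comp continuous_projIcc
  let g (z : C(Icc (0 : ℝ) T, ℝ)) : C(Icc (0 : ℝ) T, ℝ) :=
    ⟨fun s => f s (z s), hfc.comp_continuous (continuous_subtype_val.prodMk z.continuous)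
      fun s => ⟨s.2, mem_univ _⟩⟩
  have hgb : ∀ z s, |ext (g z) s| ≤ ‖g z‖ := fun z s => (g z).norm_coe_le_norm _
  have hdiff : ∀ z, Measurable (fun s => ext (g z) s - H s) := fun z => (hext _).measurable.sub hH
  have hdiffb : ∀ z s, |ext (g z) s - H s| ≤ ‖g z‖ + M := fun z s =>
    (abs_sub _ _).trans (add_le_add (hgb z s) (hM s))
  let Φ (z : C(Icc (0 : ℝ) T, ℝ)) : C(Icc (0 : ℝ) T, ℝ) :=
    ⟨(Icc 0 T).domRestrict fun t => y t + bvpOp α β T σ η μ δ ξ (fun s => ext (g z) s - H s) t,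
      (hy.add (hd.continuousOn_bvpOp (hdiff z) (hdiffb z))).domRestrict⟩
  obtain ⟨K, hK⟩ : ∃ K : NNReal, (K : ℝ) = L * bvpOmega α β T σ η μ δ ξ :=
    ⟨_, Real.coe_toNNReal _ (mul_nonneg hL hΩ.le)⟩
  have hlip : LipschitzWith K Φ := by
    refine LipschitzWith.of_dist_le_mul fun z w => ?_
    rw [hK, ContinuousMap.dist_le (mul_nonneg (mul_nonneg hL hΩ.le) dist_nonneg)]
    intro t
    have hzw : ∀ s ∈ Ioo 0 T, |ext (g z) s - H s - (ext (g w) s - H s)| ≤ L * dist z w :=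
      fun s _ => by
        rw [sub_sub_sub_cancel_right]
        refine (hf _ (projIcc 0 T hd.pos.le s).2 _ _).trans (mul_le_mul_of_nonneg_left ?_ hL)
        exact ContinuousMap.dist_apply_le_dist (f := z) (g := w) _
    have h1 := hd.abs_bvpOp_le (by positivity) hzw t.2
    rw [hd.bvpOp_sub (hdiff z) (hdiffb z) (hdiff w) (hdiffb w) t.2] at h1
    rw [Real.dist_eq]
    change |y t + _ - (y t + _)| ≤ L * bvpOmega α β T σ η μ δ ξ * dist z w
    rw [add_sub_add_left_eq_sub]
    linarith
  have hcontr : ContractingWith K Φ :=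
    ⟨by rwa [← NNReal.coe_lt_coe, hK], hlip⟩
  set z := hcontr.fixedPoint Φ
  have hz : Φ z = z := hcontr.fixedPoint_isFixedPt
  refine ⟨ext z, ext (g z), ‖g z‖, (hext z).continuousOn, hext _, hgb z, fun t ht => ?_,
    fun t ht => ?_⟩
  · simp only [ext, projIcc_of_mem hd.pos.le ht]
    rfl
  · have := congrArg (fun w : C(Icc (0 : ℝ) T, ℝ) => w ⟨t, ht⟩) hz
    simp only [ext, projIcc_of_mem hd.pos.le ht]
    exact this.symm

theorem abs_sub_le_of_solvesProblem (hd : IsAdmissible α β T σ η μ δ ξ) {f : ℝ → ℝ → ℝ} {L ε : ℝ}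
    {x y : ℝ → ℝ} (hL : 0 ≤ L)
    (hfc : ContinuousOn (fun p : ℝ × ℝ => f p.1 p.2) (Icc 0 T ×ˢ univ))
    (hf : ∀ t ∈ Icc 0 T, ∀ x y : ℝ, |f t x - f t y| ≤ L * |x - y|)
    (hLΩ : L * bvpOmega α β T σ η μ δ ξ < 1) (hε : 0 ≤ ε)
    (hx : SolvesProblem α β T f σ η μ δ ξ x) (hy : SolvesPerturbedProblem α β T f σ η μ δ ξ ε y)
    {t : ℝ} (ht : t ∈ Icc 0 T) :
    |y t - x t| ≤ bvpOmega α β T σ η μ δ ξ / (1 - L * bvpOmega α β T σ η μ δ ξ) * ε := by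
  -- An exact solution is an approximate one with ε = 0, so the same representation applies to it.
  have hx' : SolvesPerturbedProblem α β T f σ η μ δ ξ 0 x :=
    ⟨⟨hx.1.1, _, hx.1.2, fun t _ => by simp⟩, hx.2⟩
  obtain ⟨F, N, hF, hN, hFf, hxF⟩ := hd.exists_eq_bvpOp hfc hx'
  obtain ⟨H, M, hH, hM, hHf, hyH⟩ := hd.exists_eq_bvpOp hfc hy
  refine hd.abs_sub_le hL hf hLΩ hε hx.1.1 hy.1.1
    (fun s hs => sub_eq_zero.1 (abs_nonpos_iff.1 (hFf s hs))) hHf (fun s hs => ?_) ht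
  rw [hd.bvpOp_sub hF hN hH hM hs, hxF hs, hyH hs]

theorem exists_solvesProblem (hd : IsAdmissible α β T σ η μ δ ξ) {f : ℝ → ℝ → ℝ} {L : ℝ}
    (hL : 0 ≤ L) (hfc : ContinuousOn (fun p : ℝ × ℝ => f p.1 p.2) (Icc 0 T ×ˢ univ))
    (hf : ∀ t ∈ Icc 0 T, ∀ x y : ℝ, |f t x - f t y| ≤ L * |x - y|)
    (hLΩ : L * bvpOmega α β T σ η μ δ ξ < 1) :
    ∃ x, SolvesProblem α β T f σ η μ δ ξ x := by
  obtain ⟨x, F, N, hx, hF, hN, hFf, hxF⟩ := hd.exists_fixedPoint (y := fun _ => 0) (H := fun _ => 0)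
    (M := 0) hL hfc hf hLΩ continuousOn_const measurable_const (by simp)
  simp only [sub_zero, zero_add] at hxF
  refine ⟨x, ⟨hx, ?_⟩, (hd.boundaryConditions_iff hF.measurable hN hxF).2 rfl⟩
  refine (hasHilferDeriv_of_eq (c₀ := 0) (c := bvpCoeff α β T σ η μ δ ξ F)
    hd.one_lt hd.lt_two hd.zero_le hd.le_one hd.pos (fun _ => rfl) hF hN fun t ht => ?_).congr hFf
  rw [hxF t ht, bvpOp, zero_add]

/-- The correction x - y = `bvpOp` (F - H) changes the coefficient of t^(γ-1) and replaces H by F in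
the representation of y, so x solves the equation with the same c₀. -/
theorem exists_solvesEquation (hd : IsAdmissible α β T σ η μ δ ξ) {f : ℝ → ℝ → ℝ} {L ε : ℝ}
    {y : ℝ → ℝ} (hL : 0 ≤ L)
    (hfc : ContinuousOn (fun p : ℝ × ℝ => f p.1 p.2) (Icc 0 T ×ˢ univ))
    (hf : ∀ t ∈ Icc 0 T, ∀ x y : ℝ, |f t x - f t y| ≤ L * |x - y|)
    (hLΩ : L * bvpOmega α β T σ η μ δ ξ < 1) (hε : 0 ≤ ε) (hy : SolvesInequality α β T f ε y) :
    ∃ x, SolvesEquation α β T f x ∧ ∀ t ∈ Icc 0 T,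
      |y t - x t| ≤ bvpOmega α β T σ η μ δ ξ / (1 - L * bvpOmega α β T σ η μ δ ξ) * ε := by
  obtain ⟨H, M, c₀, c, hH, hM, hHf, hc₀, hyH⟩ := hd.exists_eq_of_solvesInequality hfc hy
  obtain ⟨x, F, N, hx, hF, hN, hFf, hxF⟩ := hd.exists_fixedPoint hL hfc hf hLΩ hy.1 hH hM
  refine ⟨x, ⟨hx, ?_⟩, fun t ht => hd.abs_sub_le hL hf hLΩ hε hx hy.1
    (fun s hs => hFf (Ioo_subset_Icc_self hs)) hHf (fun s hs => by rw [hxF s hs]; ring) ht⟩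
  refine (hasHilferDeriv_of_eq (c₀ := c₀) (c := c + bvpCoeff α β T σ η μ δ ξ fun s => F s - H s)
    hd.one_lt hd.lt_two hd.zero_le hd.le_one hd.pos hc₀ hF hN fun t ht => ?_).congr hFf
  rw [hxF t ht, hyH t ht, bvpOp, rlIntegral_sub (by linarith [hd.one_lt]) ht.1 hF.measurable
    (fun s _ => hN s) hH fun s _ => hM s]
  ring

end IsAdmissible

/-! ### Ulam–Hyers stability -/

theorem UlamHyersStableWith.generalized {T C : ℝ} {Sol : (ℝ → ℝ) → Prop}
    {Approx : ℝ → (ℝ → ℝ) → Prop} (h : UlamHyersStableWith T Sol Approx C) :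
    GeneralizedUlamHyersStable T Sol Approx :=
  ⟨fun ε => C * ε, by fun_prop, fun r hr => mul_nonneg h.1.le hr, mul_zero C, h.2⟩

end

theorem mainTheorem3 (α β T L : ℝ) (hα1 : 1 < α) (hα2 : α < 2) (hβ0 : 0 ≤ β) (hβ1 : β ≤ 1)
    (hT : 0 < T) (m : ℕ) (σ η μ δ ξ : Fin m → ℝ)
    (hη : ∀ i, 0 < η i) (hδ : ∀ i, 0 < δ i) (hξ : ∀ i, ξ i ∈ Set.Ioo 0 T)
    (hμ : ∀ i, 0 < μ i + (hilferGamma α β - 1) / η i + 1)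
    (hΔ : bvpDelta α β T σ η μ δ ξ ≠ 0)
    (f : ℝ → ℝ → ℝ)
    (H1 : ContinuousOn (fun p : ℝ × ℝ => f p.1 p.2) (Set.Icc 0 T ×ˢ Set.univ))
    (hL : 0 < L)
    (H2 : ∀ t ∈ Set.Icc (0 : ℝ) T, ∀ x y : ℝ, |f t x - f t y| ≤ L * |x - y|)
    (hLΩ : L * bvpOmega α β T σ η μ δ ξ < 1) :
    -- the unique solution of the problem, and its distance to every approximate solution
    (∃ x : ℝ → ℝ, SolvesProblem α β T f σ η μ δ ξ x ∧
      (∀ x' : ℝ → ℝ, SolvesProblem α β T f σ η μ δ ξ x' → Set.EqOn x' x (Set.Icc 0 T)) ∧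
      ∀ ε : ℝ, 0 < ε → ∀ y : ℝ → ℝ, SolvesPerturbedProblem α β T f σ η μ δ ξ ε y →
        ∀ t ∈ Set.Icc (0 : ℝ) T,
          |y t - x t| ≤
            bvpOmega α β T σ η μ δ ξ / (1 - L * bvpOmega α β T σ η μ δ ξ) * ε) ∧
    -- stability of the problem
    UlamHyersStableWith T (SolvesProblem α β T f σ η μ δ ξ)
      (SolvesPerturbedProblem α β T f σ η μ δ ξ)
      (bvpOmega α β T σ η μ δ ξ / (1 - L * bvpOmega α β T σ η μ δ ξ)) ∧
    UlamHyersStable T (SolvesProblem α β T f σ η μ δ ξ)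
      (SolvesPerturbedProblem α β T f σ η μ δ ξ) ∧
    GeneralizedUlamHyersStable T (SolvesProblem α β T f σ η μ δ ξ)
      (SolvesPerturbedProblem α β T f σ η μ δ ξ) ∧
    -- stability of the equation alone, without boundary conditions
    UlamHyersStableWith T (SolvesEquation α β T f) (SolvesInequality α β T f)
      (bvpOmega α β T σ η μ δ ξ / (1 - L * bvpOmega α β T σ η μ δ ξ)) ∧
    UlamHyersStable T (SolvesEquation α β T f) (SolvesInequality α β T f) ∧
    GeneralizedUlamHyersStable T (SolvesEquation α β T f) (SolvesInequality α β T f) := by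
  have hd : IsAdmissible α β T σ η μ δ ξ := ⟨hα1, hα2, hβ0, hβ1, hT, hη, hδ, hξ, hμ, hΔ⟩
  have hC : 0 < bvpOmega α β T σ η μ δ ξ / (1 - L * bvpOmega α β T σ η μ δ ξ) :=
    div_pos hd.omega_pos (sub_pos.2 hLΩ)
  obtain ⟨x, hx⟩ := hd.exists_solvesProblem hL.le H1 H2 hLΩ
  have hdist : ∀ ε : ℝ, 0 ≤ ε → ∀ y : ℝ → ℝ, SolvesPerturbedProblem α β T f σ η μ δ ξ ε y →
      ∀ t ∈ Set.Icc (0 : ℝ) T, |y t - x t| ≤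
        bvpOmega α β T σ η μ δ ξ / (1 - L * bvpOmega α β T σ η μ δ ξ) * ε :=
    fun ε hε y hy t ht => hd.abs_sub_le_of_solvesProblem hL.le H1 H2 hLΩ hε hx hy ht
  have hproblem : UlamHyersStableWith T (SolvesProblem α β T f σ η μ δ ξ)
      (SolvesPerturbedProblem α β T f σ η μ δ ξ)
      (bvpOmega α β T σ η μ δ ξ / (1 - L * bvpOmega α β T σ η μ δ ξ)) :=
    ⟨hC, fun ε hε y hy => ⟨x, hx, hdist ε hε.le y hy⟩⟩
  have hequation : UlamHyersStableWith T (SolvesEquation α β T f) (SolvesInequality α β T f)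
      (bvpOmega α β T σ η μ δ ξ / (1 - L * bvpOmega α β T σ η μ δ ξ)) :=
    ⟨hC, fun ε hε y hy => hd.exists_solvesEquation hL.le H1 H2 hLΩ hε.le hy⟩
  refine ⟨⟨x, hx, fun x' hx' t ht => ?_, fun ε hε => hdist ε hε.le⟩, hproblem, ⟨_, hproblem⟩,
    hproblem.generalized, hequation, ⟨_, hequation⟩, hequation.generalized⟩
  -- Uniqueness is the stability estimate at ε = 0.
  have h0 := hdist 0 le_rfl x' ⟨⟨hx'.1.1, _, hx'.1.2, fun t _ => by simp⟩, hx'.2⟩ t ht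
  rw [mul_zero] at h0
  exact sub_eq_zero.1 (abs_nonpos_iff.1 h0)
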